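/- Let $F$ be a non-archimedean locally compact field, $A$ a finite-dimensional central simple $F$-algebra, $V$ a simple left $A$-module, and $D$ the opposite algebra of $\mathrm{End}_A(V)$, so that $V$ is a right $D$-vector space and $A=\mathrm{End}_D(V)$. Let $E/F$ be a finite field extension with a fixed embedding of $F$-algebras $E\hookrightarrow A$, let $B$ be the centralizer of $E$ in $A$, let $V_E$ be a simple left $B$-module, and let $D_E$ be the opposite algebra of $\mathrm{End}_B(V_E)$. Write $\mathcal O_D$ for the ring of integers of $D$ and $\mathfrak p_D$ for its maximal ideal, and similarly for $D_E$. An $\mathcal O_D$-lattice sequence of $V$ is a decreasing sequence $\Lambda=(\Lambda_k)_{k\in\mathbb Z}$ of $\mathcal O_D$-lattices of $V$ for which there is an integer $e\ge 1$ with $\Lambda_{k+e}=\Lambda_k\mathfrak p_D$ for all $k$. It is strict if it is strictly decreasing. For $k\in\mathbb Z$ put $\mathfrak a_k(\Lambda)=\{a\in A: a\Lambda_l\subset\Lambda_{l+k}\text{ for all }l\in\mathbb Z\}$. Let $\mathfrak K(\Lambda)$, the normalizer of $\Lambda$ in $A^\times$, be the group of all $g\in A^\times$ for which there is $n\in\mathbb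 Z$ with $g\Lambda_k=\Lambda_{k+n}$ for all $k$. The sequence $\Lambda$ is $E$-pure if $E^\times\subset\mathfrak K(\Lambda)$. For an $\mathcal O_{D_E}$-lattice sequence $\Gamma$ of $V_E$, the sets $\mathfrak b_k(\Gamma)\subset B$ and the normalizer of $\Gamma$ in $B^\times$ are defined in the same way, and $\mathfrak b_x(\Gamma)=\mathfrak b_{\lceil x\rceil}(\Gamma)$ for real $x$. **Theorem.** Let $\Gamma$ be a strict $\mathcal O_{D_E}$-lattice sequence of $V_E$. There exist an integer $\rho\ge 1$ and a strict $E$-pure $\mathcal O_D$-lattice sequence $\Lambda$ of $V$ such that $$\mathfrak a_k(\Lambda)\cap B=\mathfrak b_{k/\rho}(\Gamma)\quad\text{for all }k\in\mathbb Z.$$ The pair $(\rho,\Lambda)$ is unique up to translation of $\Lambda$: if $(\rho',\Lambda')$ is another such pair, then $\rho'=\rho$ and there is $n\in\mathbb Z$ with $\Lambda'_k=\Lambda_{k+n}$ for all $k$. Moreover, the normalizer of $\Gamma$ in $B^\times$ is equal to $\mathfrak K(\Lambda)\cap B^\times$. -/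

import Mathlib

open scoped ValuativeRel

/-! Throughout, `F` is a non-archimedean local field with ring of integers `𝒪[F]`, `A` is a
finite dimensional `F`-algebra, `V` is a left `A`-module, and `D` is the opposite of the algebra
`Module.End A V`. The right action of `D` on `V` is `v · δ = δ v`. An algebra and its opposite
have the same integral elements and the same units, so the definitions below speak about elements
`δ` of `Module.End A V`. They are also used for the commutant `B` of a finite extension `E / F`
in `A` and a `B`-module `V_E`: an element of a finite dimensional `E`-algebra is integral over the
ring of integers of `E` if and only if it is integral over `𝒪[F]`. -/

section LatticeSequences

variable (F : Type*) [Field F] [ValuativeRel F]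
  (A : Type*) [Ring A] [Algebra F A]
  (V : Type*) [AddCommGroup V] [Module F V] [Module A V] [IsScalarTower F A V]

/-- The ring of integers `𝒪_D` of `D`, as a set: the elements which are integral over `𝒪[F]`. -/
def integersD : Set (Module.End A V) :=
  {δ | IsIntegral 𝒪[F] δ}

/-- The maximal ideal `𝔭_D` of `𝒪_D`, as a set: the elements of `𝒪_D` which are not
invertible in `𝒪_D`. -/
def maxIdealD : Set (Module.End A V) :=
  {δ | δ ∈ integersD F A V ∧ ¬ ∃ ε ∈ integersD F A V, δ * ε = 1 ∧ ε * δ = 1}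

variable {F A V}

/-- `L` is an `𝒪_D`-lattice of `V`: a finitely generated `𝒪[F]`-submodule which spans `V` over `F`
and is stable under `𝒪_D`. (As `𝒪_D` is finitely generated over `𝒪[F]` and spans `D` over `F`,
these are the finitely generated `𝒪_D`-submodules which span `V` over `D`.) -/
structure IsLatticeD (A : Type*) [Ring A] [Algebra F A] [Module A V] [IsScalarTower F A V]
    (L : Submodule 𝒪[F] V) : Prop where
  fg : L.FG
  span_eq_top : Submodule.span F (L : Set V) = ⊤
  stable : ∀ δ ∈ integersD F A V, ∀ v ∈ L, δ v ∈ L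

/-- The submodule `L 𝔭_D`, generated by the products `v · δ = δ v` with `v ∈ L`, `δ ∈ 𝔭_D`. -/
noncomputable def mulMaxIdealD (A : Type*) [Ring A] [Algebra F A] [Module A V] [IsScalarTower F A V]
    (L : Submodule 𝒪[F] V) : Submodule 𝒪[F] V :=
  Submodule.span 𝒪[F] {w | ∃ δ ∈ maxIdealD F A V, ∃ v ∈ L, δ v = w}

variable (F A V)

/-- An `𝒪_D`-lattice sequence of `V`. -/
structure LatticeSeq where
  /-- The `k`-th lattice `Λ_k`. -/
  lat : ℤ → Submodule 𝒪[F] V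
  isLattice : ∀ k, IsLatticeD A (lat k)
  antitone : Antitone lat
  exists_period : ∃ e : ℤ, 1 ≤ e ∧ ∀ k, lat (k + e) = mulMaxIdealD A (lat k)

namespace LatticeSeq

variable {F A V}

/-- A lattice sequence is strict (a lattice chain) if it is strictly decreasing. -/
def IsStrict (Λ : LatticeSeq F A V) : Prop :=
  StrictAnti Λ.lat

/-- `Λ'` is a translate of `Λ`. -/
def IsTranslate (Λ Λ' : LatticeSeq F A V) : Prop :=
  ∃ n : ℤ, ∀ k, Λ'.lat k = Λ.lat (k + n)

/-- `𝔞_k(Λ) = {a ∈ A | a Λ_l ⊆ Λ_{l+k} for all l}`. -/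
def filtration (Λ : LatticeSeq F A V) (k : ℤ) : Submodule 𝒪[F] A where
  carrier := {a | ∀ l : ℤ, ∀ v ∈ Λ.lat l, a • v ∈ Λ.lat (l + k)}
  add_mem' := by
    intro a b ha hb l v hv
    rw [add_smul]
    exact add_mem (ha l v hv) (hb l v hv)
  zero_mem' := by
    intro l v _
    rw [zero_smul]
    exact zero_mem _
  smul_mem' := by
    intro c a ha l v hv
    have h : (c • a) • v = c • (a • v) := smul_assoc (c : F) a v
    rw [h]
    exact Submodule.smul_mem _ c (ha l v hv)

/-- The extension of `k ↦ 𝔞_k(Λ)` to real indices: `𝔞_x(Λ) = 𝔞_{⌈x⌉}(Λ)`. -/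
noncomputable def filtrationReal (Λ : LatticeSeq F A V) (x : ℝ) : Submodule 𝒪[F] A :=
  Λ.filtration ⌈x⌉

/-- The normalizer `𝔎(Λ)` of `Λ` in `Aˣ`: the `g` for which there is an integer `n` such that
`g Λ_k = Λ_{k+n}` for all `k`. -/
def normalizer (Λ : LatticeSeq F A V) : Subgroup Aˣ where
  carrier := {g | ∃ n : ℤ, ∀ k : ℤ,
    (fun v : V => (g : A) • v) '' (Λ.lat k : Set V) = (Λ.lat (k + n) : Set V)}
  one_mem' := ⟨0, fun k => by simp⟩
  mul_mem' := by
    rintro g h ⟨n, hn⟩ ⟨m, hm⟩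
    refine ⟨m + n, fun k => ?_⟩
    rw [← add_assoc, ← hn, ← hm, Set.image_image]
    simp only [Units.val_mul, mul_smul]
  inv_mem' := by
    rintro g ⟨n, hn⟩
    refine ⟨-n, fun k => ?_⟩
    have h := hn (k + -n)
    rw [neg_add_cancel_right] at h
    rw [← h, Set.image_image]
    simp [smul_smul]

/-- `Λ` is `E`-pure, for `E` embedded in `A` by `ι`: it is normalized by `Eˣ`. -/
def IsPure {E : Type*} [Field E] [Algebra F E] (ι : E →ₐ[F] A) (Λ : LatticeSeq F A V) : Prop :=
  ∀ x : Eˣ, Units.map (ι : E →* A) x ∈ Λ.normalizer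

end LatticeSeq

end LatticeSequences

/-- The commutant `B` of (the image of) `E` in `A`. -/
abbrev commutant {F : Type*} [Field F] {A : Type*} [Ring A] [Algebra F A]
    {E : Type*} [Field E] [Algebra F E] (ι : E →ₐ[F] A) : Subalgebra F A :=
  Subalgebra.centralizer F (Set.range ι)

/-- `Λ` is a strict `E`-pure sequence and `𝔞_k(Λ) ∩ B = 𝔟_{k/ρ}(Γ)` for all `k`, where `𝔟` is the
filtration of `B` defined by the lattice sequence `Γ`. -/
def IsStrictPureLift {F : Type*} [Field F] [ValuativeRel F]
    {A : Type*} [Ring A] [Algebra F A]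
    {V : Type*} [AddCommGroup V] [Module F V] [Module A V] [IsScalarTower F A V]
    {E : Type*} [Field E] [Algebra F E] (ι : E →ₐ[F] A)
    {VE : Type*} [AddCommGroup VE] [Module F VE] [Module (commutant ι) VE]
    [IsScalarTower F (commutant ι) VE]
    (Γ : LatticeSeq F (commutant ι) VE) (ρ : ℕ) (Λ : LatticeSeq F A V) : Prop :=
  Λ.IsStrict ∧ Λ.IsPure ι ∧
    ∀ k : ℤ, ∀ b : commutant ι,
      (b : A) ∈ Λ.filtration k ↔ b ∈ Γ.filtrationReal ((k : ℝ) / (ρ : ℝ))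

/-! A lattice sequence on `V` amounts to an integer-valued order function on nonzero vectors that is
ultrametric and that `D` translates through its valuation. Then `a ∈ 𝔞_k` means that `a` raises
every order by at least `k`, and `g` normalizes the sequence exactly when it shifts all orders by
one constant. Everything becomes a comparison of order functions.

Two facts carry the proof. The first is orthogonality (`exists_linearMap_map_eq_of_ord`): a nonzero
`x` has an orthogonal complement, so any `y` is the image of `x` under a linear map raising orders
by at least `ord y - ord x`. It is used over `D`, over `D_E`, and over `E` when the sequence is
`E`-pure.

The second is a valuation-preserving form of the fact that `D` and `A` together generate `End_F(V)`
(`IsCyclicGenerator.exists_decomposition`). The algebra `D` is topologically generated by a root of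
unity `ζ` of order prime to the residue characteristic and a uniformizer `ϖ` normalizing `⟨ζ⟩`.
Averaging over conjugates by `ϖ ^ i * ζ ^ j` writes an `F`-endomorphism as a sum of products `d t *
b t`, with `d t` in `D` and `b t` in `A`, without loss of valuation; if the endomorphism is
`E`-linear, every `b t` lies in `B`.

Together (`exists_sum_commutant`) they give, for a pure `Λ`, an expression of `y` as a sum of `d t
(b t • x)` with `b t` in `B` at the level of `𝔞` that the orders predict. Hence the sets `𝔞_k ∩ B`
control all differences of orders. This yields uniqueness, and also that an element normalizing `Γ`
normalizes `Λ`.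

For existence, `V` has no proper nonzero subgroup stable under both `D` and `B`, so `V_E` is a
direct summand of `V` over `B`, with projection `ψ`. The lattice `Λ_k` consists of the `v` with `ψ
(d v) ∈ Γ_⌈(k + e w(d)) / ρ⌉` for all nonzero `d` in `D`. The action of a uniformizer of `F` imposes
the ratio `e / ρ`; taking it in lowest terms makes `Λ` strict. On the copy of `V_E` the order of `Λ`
is `ρ` times that of `Γ` up to a constant (`ord_map_eq`), which recovers `𝔟` from `𝔞`. -/

set_option linter.unusedSectionVars false
set_option linter.style.haveILetI false

/-! ### The spectral norm of a finite-dimensional division algebra -/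

section SpectralNorm

open Polynomial

/-- The spectral value of the minimal polynomial of an element of an algebra. -/
noncomputable def algSpectralNorm (F : Type*) [NormedField F] {Δ : Type*} [Ring Δ] [Algebra F Δ]
    (x : Δ) : ℝ :=
  spectralValue (minpoly F x)

variable {F : Type*} [NontriviallyNormedField F] [IsUltrametricDist F] [CompleteSpace F]
  {Δ : Type*} [DivisionRing Δ] [Algebra F Δ] [FiniteDimensional F Δ]

theorem algSpectralNorm_eq_spectralNorm_root (x : Δ) [Fact (Irreducible (minpoly F x))] :
    algSpectralNorm F x = spectralNorm F (AdjoinRoot (minpoly F x)) (AdjoinRoot.root _) := by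
  unfold algSpectralNorm spectralNorm
  rw [AdjoinRoot.minpoly_root (minpoly.ne_zero (Algebra.IsIntegral.isIntegral x)),
    (minpoly.monic (Algebra.IsIntegral.isIntegral x)).leadingCoeff]
  simp

theorem exists_algHom_adjoinRoot_minpoly (x : Δ) :
    ∃ φ : AdjoinRoot (minpoly F x) →ₐ[F] Δ, φ (AdjoinRoot.root _) = x := by
  let φ : (F[X] ⧸ Ideal.span {minpoly F x}) →ₐ[F] Δ := Ideal.Quotient.liftₐ _ (aeval x) (by
    intro a ha
    obtain ⟨b, rfl⟩ := Ideal.mem_span_singleton.1 ha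
    simp)
  have hφ : φ (Ideal.Quotient.mk _ X) = x :=
    (Ideal.Quotient.lift_mk _ (aeval x : F[X] →ₐ[F] Δ).toRingHom _).trans (aeval_X x)
  exact ⟨φ, hφ⟩

/-- Left multiplication by `x` on `Δ` is a scalar of the field `K = F(x)`, so its determinant is the
norm of `x` from `K` to the power `[Δ : K]`, and over a complete field that norm determines the
spectral norm. Multiplicativity follows even for `x`, `y` lying in no common commutative subfield.
-/
theorem algSpectralNorm_pow_finrank (x : Δ) :
    algSpectralNorm F x ^ Module.finrank F Δ = ‖Algebra.norm F x‖ := by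
  have hx : IsIntegral F x := Algebra.IsIntegral.isIntegral x
  haveI hirr : Fact (Irreducible (minpoly F x)) := ⟨minpoly.irreducible hx⟩
  have h0 := minpoly.ne_zero hx
  set K := AdjoinRoot (minpoly F x) with hK
  obtain ⟨φ, hφ⟩ := exists_algHom_adjoinRoot_minpoly (F := F) x
  letI : Module K Δ := Module.compHom Δ φ.toRingHom
  have hsmul : ∀ (k : K) (d : Δ), k • d = φ k * d := fun _ _ => rfl
  haveI : IsScalarTower F K Δ := ⟨fun a k d => by simp [hsmul]⟩
  let pb := AdjoinRoot.powerBasis h0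
  haveI : FiniteDimensional F K := pb.finite
  haveI : Module.Finite K Δ := Module.Finite.of_restrictScalars_finite F K Δ
  have hlin : (LinearMap.mulLeft F x) =
      ((AdjoinRoot.root (minpoly F x) : K) • (LinearMap.id : Δ →ₗ[K] Δ)).restrictScalars F := by
    ext d
    simp [hsmul, hφ]
  have hmin : minpoly F (AdjoinRoot.root (minpoly F x)) = minpoly F x := by
    rw [AdjoinRoot.minpoly_root h0, (minpoly.monic hx).leadingCoeff]; simp
  have hnorm : ‖Algebra.norm F (AdjoinRoot.root (minpoly F x) : K)‖ = ‖(minpoly F x).coeff 0‖ := by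
    have := Algebra.PowerBasis.norm_gen_eq_coeff_zero_minpoly pb
    rw [AdjoinRoot.powerBasis_gen, hmin] at this
    rw [this]; simp
  have hdeg : Module.finrank F K = (minpoly F x).natDegree := by
    rw [pb.finrank, AdjoinRoot.powerBasis_dim]
  have hdeg0 : (minpoly F x).natDegree ≠ 0 := (minpoly.natDegree_pos hx).ne'
  have h1 : ‖Algebra.norm F x‖ = ‖(minpoly F x).coeff 0‖ ^ Module.finrank K Δ := by
    rw [Algebra.norm_apply]
    change ‖LinearMap.det (LinearMap.mulLeft F x)‖ = _
    rw [hlin, LinearMap.det_restrictScalars, LinearMap.det_smul, LinearMap.det_id, mul_one,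
      map_pow, norm_pow, hnorm]
  rw [h1, algSpectralNorm_eq_spectralNorm_root, spectralNorm.spectralNorm_eq_norm_coeff_zero_rpow, hmin,
    ← Module.finrank_mul_finrank F K Δ, pow_mul, hdeg]
  congr 1
  rw [← Real.rpow_natCast, ← Real.rpow_mul (norm_nonneg _), one_div_mul_cancel
    (by exact_mod_cast hdeg0), Real.rpow_one]

theorem algSpectralNorm_nonneg (x : Δ) : 0 ≤ algSpectralNorm F x :=
  spectralValue_nonneg _

theorem algSpectralNorm_mul (x y : Δ) :
    algSpectralNorm F (x * y) = algSpectralNorm F x * algSpectralNorm F y := by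
  have hn : Module.finrank F Δ ≠ 0 := Module.finrank_pos.ne'
  refine (pow_left_inj₀ (algSpectralNorm_nonneg _)
    (mul_nonneg (algSpectralNorm_nonneg _) (algSpectralNorm_nonneg _)) hn).1 ?_
  rw [mul_pow, algSpectralNorm_pow_finrank, algSpectralNorm_pow_finrank,
    algSpectralNorm_pow_finrank, map_mul, norm_mul]

theorem algSpectralNorm_algebraMap (a : F) : algSpectralNorm F (algebraMap F Δ a) = ‖a‖ := by
  unfold algSpectralNorm
  rw [minpoly.eq_X_sub_C, spectralValue_X_sub_C]

theorem algSpectralNorm_zero : algSpectralNorm F (0 : Δ) = 0 := by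
  simpa using algSpectralNorm_algebraMap (Δ := Δ) (0 : F)

theorem algSpectralNorm_one : algSpectralNorm F (1 : Δ) = 1 := by
  simpa using algSpectralNorm_algebraMap (Δ := Δ) (1 : F)

theorem algSpectralNorm_ne_zero {x : Δ} (hx : x ≠ 0) : algSpectralNorm F x ≠ 0 := by
  intro h
  have h1 := algSpectralNorm_mul (F := F) x x⁻¹
  rw [mul_inv_cancel₀ hx, h, zero_mul, algSpectralNorm_one] at h1
  exact one_ne_zero h1

theorem algSpectralNorm_add_one_le (x : Δ) :
    algSpectralNorm F (x + 1) ≤ max (algSpectralNorm F x) 1 := by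
  have hx : IsIntegral F x := Algebra.IsIntegral.isIntegral x
  haveI hirr : Fact (Irreducible (minpoly F x)) := ⟨minpoly.irreducible hx⟩
  haveI : FiniteDimensional F (AdjoinRoot (minpoly F x)) :=
    (AdjoinRoot.powerBasis (minpoly.ne_zero hx)).finite
  have h1 : algSpectralNorm F (x + 1) =
      spectralNorm F (AdjoinRoot (minpoly F x)) (AdjoinRoot.root _ + 1) := by
    unfold algSpectralNorm spectralNorm
    obtain ⟨φ, hφ⟩ := exists_algHom_adjoinRoot_minpoly (F := F) x
    rw [← minpoly.algHom_eq φ φ.toRingHom.injective (AdjoinRoot.root _ + 1), map_add, hφ, map_one]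
  rw [h1, algSpectralNorm_eq_spectralNorm_root, ← spectralNorm_one (K := F)
    (L := AdjoinRoot (minpoly F x))]
  exact isNonarchimedean_spectralNorm _ _

/-- Dividing by `y` reduces to `x * y⁻¹ + 1`, which lives in a commutative field, where the
ultrametric inequality is known. -/
theorem algSpectralNorm_add_le_max (x y : Δ) :
    algSpectralNorm F (x + y) ≤ max (algSpectralNorm F x) (algSpectralNorm F y) := by
  by_cases hy : y = 0
  · simp [hy]
  have h : x + y = (x * y⁻¹ + 1) * y := by rw [add_mul, mul_assoc, inv_mul_cancel₀ hy]; simp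
  have h2 : x = (x * y⁻¹) * y := by rw [mul_assoc, inv_mul_cancel₀ hy]; simp
  rw [h, algSpectralNorm_mul]
  calc _ ≤ max (algSpectralNorm F (x * y⁻¹)) 1 * algSpectralNorm F y :=
        mul_le_mul_of_nonneg_right (algSpectralNorm_add_one_le _) (algSpectralNorm_nonneg _)
    _ = _ := by
        rw [max_mul_of_nonneg _ _ (algSpectralNorm_nonneg _), ← algSpectralNorm_mul, ← h2, one_mul]

theorem algSpectralNorm_neg (x : Δ) : algSpectralNorm F (-x) = algSpectralNorm F x := by
  have : -x = algebraMap F Δ (-1) * x := by simp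
  rw [this, algSpectralNorm_mul, algSpectralNorm_algebraMap, norm_neg, norm_one, one_mul]

variable (F Δ) in
/-- The spectral norm of a finite dimensional division algebra over a complete field. -/
@[reducible] noncomputable def spectralNormedDivisionRing : NormedDivisionRing Δ where
  __ := ‹DivisionRing Δ›
  norm := algSpectralNorm F
  dist x y := algSpectralNorm F (-x + y)
  dist_self x := by simp [algSpectralNorm_zero]
  dist_comm x y := by rw [← algSpectralNorm_neg]; congr 1; abel
  dist_triangle x y z := by
    have := algSpectralNorm_add_le_max (F := F) (-x + y) (-y + z)
    rw [show -x + y + (-y + z) = -x + z by abel] at this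
    exact this.trans (max_le_add_of_nonneg (algSpectralNorm_nonneg _) (algSpectralNorm_nonneg _))
  eq_of_dist_eq_zero {x y} h := by
    by_contra hne
    exact algSpectralNorm_ne_zero (F := F)
      (fun h0 => hne (neg_injective (add_eq_zero_iff_eq_neg.1 h0))) h
  dist_eq x y := rfl
  norm_mul := algSpectralNorm_mul

end SpectralNorm

theorem Finset.sum_range_succ_eq_of_eq {M : Type*} [AddCommGroup M] (f : ℕ → M) {N : ℕ}
    (h : f N = f 0) : ∑ j ∈ Finset.range N, f (j + 1) = ∑ j ∈ Finset.range N, f j := by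
  have h1 := Finset.sum_range_succ f N
  rw [Finset.sum_range_succ', h] at h1
  exact add_right_cancel h1

theorem exists_generator_of_finite_isDomain (k : Type*) [Ring k] [IsDomain k] [Finite k] :
    ∃ g : k, g ≠ 0 ∧ (∀ x : k, x ≠ 0 → ∃ i : ℕ, x = g ^ i) ∧ g ^ Nat.card k = g := by
  classical
  haveI : Fintype k := Fintype.ofFinite k
  letI : DivisionRing k := Fintype.divisionRingOfIsDomain k
  letI : Field k := littleWedderburn k
  obtain ⟨g, hg⟩ := IsCyclic.exists_generator (α := kˣ)
  refine ⟨g, g.ne_zero, fun x hx => ?_, ?_⟩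
  · obtain ⟨i, hi⟩ := (mem_powers_iff_mem_zpowers).2 (hg (Units.mk0 x hx))
    exact ⟨i, by simpa using (congrArg Units.val hi).symm⟩
  · rw [Nat.card_eq_fintype_card]
    exact FiniteField.pow_card _

/-! ### Teichmüller root of unity and a uniformizer normalizing it -/

section Normed

variable {F : Type*} [NontriviallyNormedField F] [ProperSpace F]
  {Δ : Type*} [NormedDivisionRing Δ] [NormedAlgebra F Δ] [FiniteDimensional F Δ]
  [IsUltrametricDist Δ]

/-- The open unit ball is also closed, hence compact, so the norm attains its maximum on it. -/
theorem exists_norm_lt_one_max (F : Type*) [NontriviallyNormedField F] [ProperSpace F]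
    (Δ : Type*) [NormedDivisionRing Δ] [NormedAlgebra F Δ] [FiniteDimensional F Δ]
    [IsUltrametricDist Δ] :
    ∃ ϖ : Δ, ϖ ≠ 0 ∧ ‖ϖ‖ < 1 ∧ ∀ x : Δ, ‖x‖ < 1 → ‖x‖ ≤ ‖ϖ‖ := by
  haveI : ProperSpace Δ := FiniteDimensional.proper F Δ
  have hcl : IsClosed (Metric.ball (0 : Δ) 1) := IsUltrametricDist.isClosed_ball 0 1
  have hc : IsCompact (Metric.ball (0 : Δ) 1) :=
    (isCompact_closedBall (0 : Δ) 1).of_isClosed_subset hcl Metric.ball_subset_closedBall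
  obtain ⟨ϖ, h1, h2⟩ := hc.exists_isMaxOn ⟨0, by simp⟩ continuous_norm.continuousOn
  have h2' : ∀ x : Δ, ‖x‖ < 1 → ‖x‖ ≤ ‖ϖ‖ := fun x hx => h2 (by simpa using hx)
  refine ⟨ϖ, ?_, by simpa using h1, h2'⟩
  rintro rfl
  obtain ⟨a, ha0, ha1⟩ := NormedField.exists_norm_lt_one F
  have := h2' (algebraMap F Δ a) (by rwa [norm_algebraMap'])
  rw [norm_algebraMap', norm_zero] at this
  exact absurd ha0 (not_lt.2 this)

theorem exists_norm_eq_zpow {ϖ : Δ} (h0 : ϖ ≠ 0) (h1 : ‖ϖ‖ < 1)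
    (hmax : ∀ x : Δ, ‖x‖ < 1 → ‖x‖ ≤ ‖ϖ‖) {x : Δ} (hx : x ≠ 0) : ∃ n : ℤ, ‖x‖ = ‖ϖ‖ ^ n := by
  have hp : 0 < ‖ϖ‖ := norm_pos_iff.2 h0
  obtain ⟨n, hn1, hn2⟩ := exists_mem_Ioc_zpow (norm_pos_iff.2 hx) ((one_lt_inv₀ hp).2 h1)
  have h3 : ‖x‖ ≤ ‖ϖ‖ ^ (-(n + 1)) := by rwa [zpow_neg, ← inv_zpow]
  have h4 : ‖ϖ‖ ^ (-n) < ‖x‖ := by rwa [zpow_neg, ← inv_zpow]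
  refine ⟨-(n + 1), le_antisymm h3 (not_lt.1 fun hlt => ?_)⟩
  have h5 := hmax (x * ϖ ^ (n + 1)) (by
    rw [norm_mul, norm_zpow]
    calc _ < ‖ϖ‖ ^ (-(n + 1)) * ‖ϖ‖ ^ (n + 1) :=
          mul_lt_mul_of_pos_right hlt (zpow_pos hp _)
      _ = 1 := by rw [← zpow_add₀ hp.ne']; simp)
  rw [norm_mul, norm_zpow] at h5
  have h6 : ‖ϖ‖ ^ (-n) * ‖ϖ‖ ^ (n + 1) < ‖x‖ * ‖ϖ‖ ^ (n + 1) :=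
    mul_lt_mul_of_pos_right h4 (zpow_pos hp _)
  rw [← zpow_add₀ hp.ne'] at h6
  simp at h6
  linarith

theorem norm_eq_of_norm_sub_lt {x y : Δ} (h : ‖x - y‖ < ‖y‖) : ‖x‖ = ‖y‖ := by
  have := IsUltrametricDist.norm_add_eq_max_of_norm_ne_norm h.ne
  rw [sub_add_cancel, max_eq_right h.le] at this
  exact this

theorem norm_pow_sub_pow_le {x y : Δ} (hx : ‖x‖ ≤ 1) (hy : ‖y‖ ≤ 1) (i : ℕ) :
    ‖x ^ i - y ^ i‖ ≤ ‖x - y‖ := by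
  induction i with
  | zero => simp
  | succ i ih =>
    have : x ^ (i + 1) - y ^ (i + 1) = x ^ i * (x - y) + (x ^ i - y ^ i) * y := by
      rw [pow_succ, pow_succ]; noncomm_ring
    rw [this]
    refine (IsUltrametricDist.norm_add_le_max _ _).trans (max_le ?_ ?_)
    · rw [norm_mul, norm_pow]
      exact mul_le_of_le_one_left (norm_nonneg _) (pow_le_one₀ (norm_nonneg _) hx)
    · rw [norm_mul]
      exact (mul_le_of_le_one_right (norm_nonneg _) hy).trans ih

variable (Δ) in
/-- The unit ball of an ultrametric division ring. -/
def unitBallSubring : Subring Δ where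
  carrier := {x | ‖x‖ ≤ 1}
  mul_mem' {x y} hx hy := by
    change ‖x * y‖ ≤ 1
    rw [norm_mul]; exact mul_le_one₀ hx (norm_nonneg _) hy
  one_mem' := by simp
  add_mem' {x y} hx hy := (IsUltrametricDist.norm_add_le_max _ _).trans (max_le hx hy)
  zero_mem' := by simp
  neg_mem' {x} hx := by simpa using hx

variable (Δ) in
/-- The open unit ball, as an ideal of the unit ball of an ultrametric division ring. -/
def openUnitBallIdeal : Ideal (unitBallSubring Δ) where
  carrier := {x | ‖(x : Δ)‖ < 1}
  add_mem' {x y} hx hy := (IsUltrametricDist.norm_add_le_max _ _).trans_lt (max_lt hx hy)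
  zero_mem' := by simp
  smul_mem' c x hx := by
    change ‖(c : Δ) * x‖ < 1
    rw [norm_mul]; exact (mul_le_of_le_one_left (norm_nonneg _) c.2).trans_lt hx

instance : (openUnitBallIdeal Δ).IsTwoSided where
  mul_mem_of_left {x} c hx := by
    change ‖(x : Δ) * c‖ < 1
    rw [norm_mul]; exact (mul_le_of_le_one_right (norm_nonneg _) c.2).trans_lt hx

theorem mk_openUnitBallIdeal_eq_iff (x y : unitBallSubring Δ) :
    Ideal.Quotient.mk (openUnitBallIdeal Δ) x = Ideal.Quotient.mk (openUnitBallIdeal Δ) y ↔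
      ‖(x : Δ) - y‖ < 1 :=
  Ideal.Quotient.mk_eq_mk_iff_sub_mem _ _

instance : IsDomain (unitBallSubring Δ ⧸ openUnitBallIdeal Δ) := by
  haveI : Nontrivial (unitBallSubring Δ ⧸ openUnitBallIdeal Δ) := by
    refine ⟨Ideal.Quotient.mk _ 0, Ideal.Quotient.mk _ 1, fun h => ?_⟩
    have := (mk_openUnitBallIdeal_eq_iff _ _).1 h
    simp at this
  haveI : NoZeroDivisors (unitBallSubring Δ ⧸ openUnitBallIdeal Δ) := by
    refine ⟨fun {a b} h => ?_⟩
    obtain ⟨x, rfl⟩ := Ideal.Quotient.mk_surjective a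
    obtain ⟨y, rfl⟩ := Ideal.Quotient.mk_surjective b
    rw [← map_mul, ← map_zero (Ideal.Quotient.mk _), mk_openUnitBallIdeal_eq_iff] at h
    rw [← map_zero (Ideal.Quotient.mk _), mk_openUnitBallIdeal_eq_iff,
      mk_openUnitBallIdeal_eq_iff]
    simp only [Subring.coe_mul, ZeroMemClass.coe_zero, sub_zero, norm_mul] at h ⊢
    by_contra! hcon
    have h1 : ‖(x : Δ)‖ = 1 := le_antisymm x.2 hcon.1
    have h2 : ‖(y : Δ)‖ = 1 := le_antisymm y.2 hcon.2
    rw [h1, h2] at h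
    norm_num at h
  exact NoZeroDivisors.to_isDomain _

theorem finite_quotient_openUnitBallIdeal (F : Type*) [NontriviallyNormedField F] [ProperSpace F]
    (Δ : Type*) [NormedDivisionRing Δ] [NormedAlgebra F Δ] [FiniteDimensional F Δ]
    [IsUltrametricDist Δ] :
    Finite (unitBallSubring Δ ⧸ openUnitBallIdeal Δ) := by
  haveI : ProperSpace Δ := FiniteDimensional.proper F Δ
  obtain ⟨t, ht, htf, hcov⟩ := (isCompact_closedBall (0 : Δ) 1).elim_finite_subcover_image
    (b := Metric.closedBall (0 : Δ) 1) (c := fun x => Metric.ball x 1)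
    (fun _ _ => Metric.isOpen_ball)
    (fun x hx => Set.mem_iUnion₂.2 ⟨x, hx, Metric.mem_ball_self one_pos⟩)
  have htf' := htf.to_subtype
  refine Finite.of_surjective (α := t) (fun x => Ideal.Quotient.mk (openUnitBallIdeal Δ)
    ⟨x, mem_closedBall_zero_iff.1 (ht x.2)⟩) fun a => ?_
  obtain ⟨y, rfl⟩ := Ideal.Quotient.mk_surjective a
  obtain ⟨x, hx, hxy⟩ := Set.mem_iUnion₂.1 (hcov (mem_closedBall_zero_iff.2 y.2))
  refine ⟨⟨x, hx⟩, (mk_openUnitBallIdeal_eq_iff _ _).2 ?_⟩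
  rw [Metric.mem_ball, dist_eq_norm] at hxy
  rw [norm_sub_rev]
  exact hxy

theorem exists_residue_generator (F : Type*) [NontriviallyNormedField F] [ProperSpace F]
    (Δ : Type*) [NormedDivisionRing Δ] [NormedAlgebra F Δ] [FiniteDimensional F Δ]
    [IsUltrametricDist Δ] : ∃ (g : Δ) (Q : ℕ), 1 < Q ∧ ‖g‖ = 1 ∧ ‖(Q : Δ)‖ < 1 ∧
    ‖g ^ Q - g‖ < 1 ∧ ∀ x : Δ, ‖x‖ = 1 → ∃ i : ℕ, ‖x - g ^ i‖ < 1 := by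
  haveI := finite_quotient_openUnitBallIdeal F Δ
  obtain ⟨a, ha0, ha, haQ⟩ :=
    exists_generator_of_finite_isDomain (unitBallSubring Δ ⧸ openUnitBallIdeal Δ)
  obtain ⟨g, rfl⟩ := Ideal.Quotient.mk_surjective a
  refine ⟨g, Nat.card (unitBallSubring Δ ⧸ openUnitBallIdeal Δ), Finite.one_lt_card, ?_, ?_, ?_, ?_⟩
  · rw [← map_zero (Ideal.Quotient.mk _), Ne, mk_openUnitBallIdeal_eq_iff] at ha0
    exact le_antisymm g.2 (by simpa using ha0)
  · have h : ((Nat.card (unitBallSubring Δ ⧸ openUnitBallIdeal Δ) : ℕ) :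
        unitBallSubring Δ ⧸ openUnitBallIdeal Δ) = 0 := by
      haveI := Fintype.ofFinite (unitBallSubring Δ ⧸ openUnitBallIdeal Δ)
      rw [Nat.card_eq_fintype_card, ← nsmul_one]
      exact card_nsmul_eq_zero
    rw [← map_natCast (Ideal.Quotient.mk (openUnitBallIdeal Δ)), ← map_zero (Ideal.Quotient.mk _),
      mk_openUnitBallIdeal_eq_iff] at h
    simpa using h
  · rw [← map_pow, mk_openUnitBallIdeal_eq_iff] at haQ
    simpa using haQ
  · intro x hx
    obtain ⟨i, hi⟩ := ha (Ideal.Quotient.mk _ ⟨x, hx.le⟩) (by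
      rw [← map_zero (Ideal.Quotient.mk _), Ne, mk_openUnitBallIdeal_eq_iff]
      simp [hx])
    rw [← map_pow, mk_openUnitBallIdeal_eq_iff] at hi
    exact ⟨i, by simpa using hi⟩

/-- The factor `∑ x ^ i * y ^ (Q - 1 - i)` of `x ^ Q - y ^ Q` differs from `Q * y ^ (Q - 1)` by
terms divisible by some `x ^ i - y ^ i`; both parts are bounded by `c`. Thus raising to the power
`Q` contracts. -/
theorem norm_pow_sub_pow_le_of_commute {x y : Δ} (hxy : Commute x y) (hx : ‖x‖ ≤ 1) (hy : ‖y‖ ≤ 1)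
    {c : ℝ} (h : ‖x - y‖ ≤ c) {Q : ℕ} (hQ : ‖(Q : Δ)‖ ≤ c) :
    ‖x ^ Q - y ^ Q‖ ≤ c * ‖x - y‖ := by
  have hc : 0 ≤ c := (norm_nonneg _).trans h
  rw [← hxy.geom_sum₂_mul Q, norm_mul]
  refine mul_le_mul_of_nonneg_right ?_ (norm_nonneg _)
  have h1 : ∑ i ∈ Finset.range Q, x ^ i * y ^ (Q - 1 - i) =
      ∑ i ∈ Finset.range Q, (x ^ i - y ^ i) * y ^ (Q - 1 - i) + Q * y ^ (Q - 1) := by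
    rw [← sub_eq_iff_eq_add', ← Finset.sum_sub_distrib]
    have : ∀ i ∈ Finset.range Q, x ^ i * y ^ (Q - 1 - i) - (x ^ i - y ^ i) * y ^ (Q - 1 - i) =
        y ^ (Q - 1) := by
      intro i hi
      rw [sub_mul, sub_sub_cancel, ← pow_add]
      congr 1
      have := Finset.mem_range.1 hi
      omega
    rw [Finset.sum_congr rfl this, Finset.sum_const, Finset.card_range, nsmul_eq_mul]
  rw [h1]
  have hyp : ∀ m : ℕ, ‖y ^ m‖ ≤ 1 := fun m => by
    rw [norm_pow]; exact pow_le_one₀ (norm_nonneg _) hy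
  refine (IsUltrametricDist.norm_add_le_max _ _).trans (max_le ?_ ?_)
  · refine IsUltrametricDist.norm_sum_le_of_forall_le_of_nonneg hc fun i _ => ?_
    rw [norm_mul]
    exact (mul_le_of_le_one_right (norm_nonneg _) (hyp _)).trans
      ((norm_pow_sub_pow_le hx hy i).trans h)
  · rw [norm_mul]
    exact (mul_le_of_le_one_right (norm_nonneg _) (hyp _)).trans hQ

/-- With `g` lifting a generator of the multiplicative group of the residue field with `Q` elements,
the powers `g ^ Q ^ n` converge to a fixed point `ζ` of `x ↦ x ^ Q` congruent to `g`. Then `N = Q -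
1` has norm one because `‖Q‖ < 1`. -/
theorem exists_teichmuller (F : Type*) [NontriviallyNormedField F] [ProperSpace F]
    (Δ : Type*) [NormedDivisionRing Δ] [NormedAlgebra F Δ] [FiniteDimensional F Δ]
    [IsUltrametricDist Δ] :
    ∃ (ζ : Δ) (N : ℕ), 0 < N ∧ ζ ^ N = 1 ∧ ‖(N : Δ)‖ = 1 ∧
    ∀ x : Δ, ‖x‖ = 1 → ∃ i : ℕ, ‖x - ζ ^ i‖ < 1 := by
  haveI : CompleteSpace Δ := FiniteDimensional.complete F Δ
  obtain ⟨g, Q, hQ1, hg, hQ, hgQ, hgen⟩ := exists_residue_generator F Δ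
  set c := max ‖(Q : Δ)‖ ‖g ^ Q - g‖ with hc
  have hc0 : 0 ≤ c := le_max_of_le_left (norm_nonneg _)
  have hc1 : c < 1 := max_lt hQ hgQ
  let z : ℕ → Δ := fun n => g ^ Q ^ n
  have hz1 : ∀ n, ‖z n‖ = 1 := fun n => by simp [z, hg]
  have hzs : ∀ n, z (n + 1) = z n ^ Q := fun n => by simp only [z]; rw [pow_succ, pow_mul]
  have hz : ∀ n, ‖z (n + 1) - z n‖ ≤ c * c ^ n := by
    intro n
    induction n with
    | zero =>
      have h := le_max_right ‖(Q : Δ)‖ ‖g ^ Q - g‖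
      rw [← hc] at h
      simpa [z] using h
    | succ n ih =>
      have h2 : z (n + 1 + 1) - z (n + 1) = z (n + 1) ^ Q - z n ^ Q := by rw [← hzs, ← hzs]
      rw [h2]
      have hcom : Commute (z (n + 1)) (z n) := (Commute.refl g).pow_pow _ _
      refine (norm_pow_sub_pow_le_of_commute hcom (hz1 _).le (hz1 _).le (ih.trans ?_)
        (le_max_left _ _)).trans (mul_le_mul_of_nonneg_left (ih.trans_eq (pow_succ' c n).symm) hc0)
      exact mul_le_of_le_one_right hc0 (pow_le_one₀ hc0 hc1.le)
  have hcau : CauchySeq z := cauchySeq_of_le_geometric c c hc1 fun n => by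
    rw [dist_comm, dist_eq_norm]; exact hz n
  obtain ⟨ζ, hζ⟩ := cauchySeq_tendsto_of_complete hcau
  have hζQ : ζ ^ Q = ζ := by
    refine tendsto_nhds_unique (hζ.pow Q) ?_
    simp only [← hzs]
    exact hζ.comp (Filter.tendsto_add_atTop_nat 1)
  have hzg : ∀ n, ‖z n - g‖ ≤ c := by
    intro n
    induction n with
    | zero => simpa [z] using hc0
    | succ n ih =>
      rw [← sub_add_sub_cancel (z (n + 1)) (z n) g]
      exact (IsUltrametricDist.norm_add_le_max _ _).trans (max_le
        ((hz n).trans (mul_le_of_le_one_right hc0 (pow_le_one₀ hc0 hc1.le))) ih)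
  have hζg : ‖ζ - g‖ ≤ c := le_of_tendsto (hζ.sub_const g).norm (Filter.Eventually.of_forall hzg)
  have hζ1 : ‖ζ‖ = 1 := tendsto_nhds_unique hζ.norm (by simp [hz1])
  have hζ0 : ζ ≠ 0 := by
    rintro rfl; simp at hζ1
  refine ⟨ζ, Q - 1, by omega, ?_, ?_, fun x hx => ?_⟩
  · have h : ζ ^ (Q - 1) * ζ = 1 * ζ := by
      rw [← pow_succ, Nat.sub_add_cancel hQ1.le, hζQ, one_mul]
    exact mul_right_cancel₀ hζ0 h
  · rw [Nat.cast_sub hQ1.le, Nat.cast_one, norm_sub_rev, ← norm_one (α := Δ)]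
    exact norm_eq_of_norm_sub_lt (by simpa using hQ)
  · obtain ⟨i, hi⟩ := hgen x hx
    refine ⟨i, ?_⟩
    rw [← sub_add_sub_cancel x (g ^ i)]
    refine (IsUltrametricDist.norm_add_le_max _ _).trans_lt (max_lt hi ?_)
    exact (norm_pow_sub_pow_le hg.le hζ1.le i).trans_lt
      ((norm_sub_rev g ζ).trans_le hζg |>.trans_lt hc1)

/-- The conjugate `ξ` of `ζ` by `ϖ₀` is congruent to some `ζ ^ r`. The sum of `ζ ^ (r * j) * ϖ₀ * (ζ
^ j)⁻¹` over `j` modulo `N` intertwines `ζ` and `ζ ^ r`. It equals `ϖ₀` times on the left a sum of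
`N` terms congruent to one, and such a sum is a unit since `‖N‖ = 1`. -/
theorem exists_uniformizer_normalizing {ζ : Δ} {N : ℕ} (hN : 0 < N) (hζ : ζ ^ N = 1)
    (hN1 : ‖(N : Δ)‖ = 1) (hgen : ∀ x : Δ, ‖x‖ = 1 → ∃ i : ℕ, ‖x - ζ ^ i‖ < 1)
    {ϖ₀ : Δ} (h0 : ϖ₀ ≠ 0) :
    ∃ (ϖ : Δ) (r : ℕ), ‖ϖ‖ = ‖ϖ₀‖ ∧ ϖ * ζ = ζ ^ r * ϖ := by
  have hζ0 : ζ ≠ 0 := by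
    rintro rfl; simp [hN.ne'] at hζ
  have hζ1 : ‖ζ‖ = 1 := by
    have := congrArg norm hζ
    rw [norm_pow, norm_one] at this
    exact (pow_eq_one_iff_of_nonneg (norm_nonneg _) hN.ne').1 this
  set ξ := ϖ₀ * ζ * ϖ₀⁻¹ with hξ
  have hξ1 : ‖ξ‖ = 1 := by
    rw [hξ, norm_mul, norm_mul, hζ1, mul_one, ← norm_mul, mul_inv_cancel₀ h0, norm_one]
  obtain ⟨r, hr⟩ := hgen ξ hξ1
  have hξpow : ∀ j : ℕ, ξ ^ j * ϖ₀ = ϖ₀ * ζ ^ j := by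
    intro j
    induction j with
    | zero => simp
    | succ j ih =>
      have h1 : ξ * ϖ₀ = ϖ₀ * ζ := by rw [hξ, mul_assoc, inv_mul_cancel₀ h0, mul_one]
      rw [pow_succ, mul_assoc, h1, ← mul_assoc, ih, mul_assoc, ← pow_succ]
  have hξ0 : ξ ≠ 0 := by
    rintro h; rw [h] at hξ1; simp at hξ1
  set f : ℕ → Δ := fun j => ζ ^ (r * j) * ϖ₀ * (ζ ^ j)⁻¹ with hf
  have hf0 : f N = f 0 := by
    simp only [hf]
    rw [mul_comm r N, pow_mul, hζ]; simp
  refine ⟨∑ j ∈ Finset.range N, f j, r, ?_, ?_⟩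
  · have h1 : (∑ j ∈ Finset.range N, f j) =
        (∑ j ∈ Finset.range N, ζ ^ (r * j) * (ξ ^ j)⁻¹) * ϖ₀ := by
      rw [Finset.sum_mul]
      refine Finset.sum_congr rfl fun j _ => ?_
      have h2 : ϖ₀ * (ζ ^ j)⁻¹ = (ξ ^ j)⁻¹ * ϖ₀ := by
        rw [eq_inv_mul_iff_mul_eq₀ (pow_ne_zero _ hξ0), ← mul_assoc, hξpow, mul_assoc,
          mul_inv_cancel₀ (pow_ne_zero _ hζ0), mul_one]
      simp only [hf]
      rw [mul_assoc, h2, mul_assoc]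
    rw [h1, norm_mul]
    have h3 : ‖∑ j ∈ Finset.range N, ζ ^ (r * j) * (ξ ^ j)⁻¹ - (N : Δ)‖ < 1 := by
      have : (N : Δ) = ∑ j ∈ Finset.range N, (1 : Δ) := by simp
      rw [this, ← Finset.sum_sub_distrib]
      have hb : ∀ j ∈ Finset.range N, ‖ζ ^ (r * j) * (ξ ^ j)⁻¹ - 1‖ ≤ ‖ξ - ζ ^ r‖ := by
        intro j _
        have : ζ ^ (r * j) * (ξ ^ j)⁻¹ - 1 = ((ζ ^ r) ^ j - ξ ^ j) * (ξ ^ j)⁻¹ := by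
          rw [sub_mul, mul_inv_cancel₀ (pow_ne_zero _ hξ0), pow_mul]
        rw [this, norm_mul, norm_inv, norm_pow, hξ1, one_pow, inv_one, mul_one, norm_sub_rev ξ]
        exact norm_pow_sub_pow_le (by simp [hζ1]) hξ1.le j
      exact (IsUltrametricDist.norm_sum_le_of_forall_le_of_nonneg (norm_nonneg _) hb).trans_lt hr
    rw [norm_eq_of_norm_sub_lt (h3.trans_eq hN1.symm), hN1, one_mul]
  · rw [Finset.mul_sum, ← Finset.sum_range_succ_eq_of_eq f hf0, Finset.sum_mul]
    refine Finset.sum_congr rfl fun j _ => ?_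
    simp only [hf]
    rw [pow_succ' ζ j, mul_inv_rev, mul_add, mul_one, pow_add, mul_assoc _ _ ζ, mul_assoc _ _ ζ,
      inv_mul_cancel₀ hζ0, mul_one, ← pow_add, add_comm, pow_add]
    simp only [mul_assoc]

/-- A point outside `U` has a nearest point in `U`, and the hypothesis applied to the difference
produces a nearer one. -/
theorem Submodule.eq_top_of_forall_norm_sub_lt (U : Submodule F Δ)
    (h : ∀ x : Δ, x ≠ 0 → ∃ u ∈ U, ‖x - u‖ < ‖x‖) : U = ⊤ := by
  haveI : ProperSpace Δ := FiniteDimensional.proper F Δ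
  refine eq_top_iff.2 fun x _ => ?_
  obtain ⟨y, hy, hxy⟩ := (Submodule.closed_of_finiteDimensional U).exists_infDist_eq_dist
    ⟨0, U.zero_mem⟩ x
  by_contra hx
  obtain ⟨u, hu, hlt⟩ := h (x - y) (fun h0 => hx (by rwa [sub_eq_zero.1 h0]))
  have h1 := Metric.infDist_le_dist_of_mem (x := x) (U.add_mem hy hu)
  rw [hxy, dist_eq_norm, dist_eq_norm, ← sub_sub] at h1
  exact absurd hlt (not_lt.2 h1)

theorem exists_basis_repr_norm_le (F : Type*) [NontriviallyNormedField F] [ProperSpace F]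
    (Δ : Type*) [NormedDivisionRing Δ] [NormedAlgebra F Δ] [FiniteDimensional F Δ]
    [IsUltrametricDist Δ] : ∃ (ι : Type) (_ : Fintype ι) (b : Module.Basis ι F Δ) (c : F),
    ∀ x : Δ, ‖x‖ ≤ 1 → ∀ i, ‖b.repr x i‖ ≤ ‖c‖ := by
  let b := Module.finBasis F Δ
  have h : ∀ i, ∃ C : ℝ, ∀ x : Δ, ‖b.coord i x‖ ≤ C * ‖x‖ := fun i =>
    ⟨_, (LinearMap.toContinuousLinearMap (b.coord i)).le_opNorm⟩
  choose C hC using h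
  obtain ⟨c, hc⟩ := NormedField.exists_lt_norm F (∑ i, |C i|)
  refine ⟨_, inferInstance, b, c, fun x hx i => ?_⟩
  calc ‖b.repr x i‖ ≤ C i * ‖x‖ := hC i x
    _ ≤ |C i| * 1 := mul_le_mul (le_abs_self _) hx (norm_nonneg _) (abs_nonneg _)
    _ ≤ ∑ i, |C i| := by
        rw [mul_one]
        exact Finset.single_le_sum (f := fun i => |C i|) (fun _ _ => abs_nonneg _)
          (Finset.mem_univ i)
    _ ≤ ‖c‖ := hc.le

end Normed

/-! ### The normalized valuation and its generators -/

/-- `w` is the normalized additive valuation of the division algebra `Δ`, whose ring of integers is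
the integral closure of `O`; the value `w 0` is irrelevant. -/
structure IsNormalizedOrd {F : Type*} [Field F] (O : Subring F) {Δ : Type*} [Ring Δ]
    [Algebra F Δ] (w : Δ → ℤ) : Prop where
  map_mul : ∀ x y, x ≠ 0 → y ≠ 0 → w (x * y) = w x + w y
  min_le_map_add : ∀ x y, x ≠ 0 → y ≠ 0 → x + y ≠ 0 → min (w x) (w y) ≤ w (x + y)
  isIntegral_iff : ∀ x, x ≠ 0 → (IsIntegral O x ↔ 0 ≤ w x)
  exists_eq_one : ∃ x, x ≠ 0 ∧ w x = 1
  exists_finset : ∃ S : Finset Δ, ∀ x, IsIntegral O x → x ∈ Submodule.span O (S : Set Δ)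

/-- A root of unity `ζ` and a uniformizer `ϖ` which normalizes the group generated by `ζ`, and which
together generate a division algebra `Δ` topologically. -/
structure IsCyclicGenerator (F : Type*) [Field F] {Δ : Type*} [DivisionRing Δ]
    [Algebra F Δ] (w : Δ → ℤ) (ζ ϖ : Δ) (N r : ℕ) : Prop where
  pos : 0 < N
  pow_eq_one : ζ ^ N = 1
  natCast_ne_zero : (N : Δ) ≠ 0
  map_natCast : w N = 0
  ne_zero : ϖ ≠ 0
  map_eq_one : w ϖ = 1
  mul_comm_pow : ϖ * ζ = ζ ^ r * ϖ
  eq_top : ∀ U : Submodule F Δ, (∀ (i : ℕ) (n : ℤ), ζ ^ i * ϖ ^ n ∈ U) → U = ⊤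

section Normed

variable {F : Type*} [NontriviallyNormedField F] [ProperSpace F] [IsUltrametricDist F]

/-- If `‖x‖ > 1`, the leading term of a monic integral equation dominates all others. Conversely,
spectral value at most one means that the minimal polynomial has integral coefficients. -/
theorem isIntegral_iff_algSpectralNorm_le_one {Δ : Type*} [DivisionRing Δ] [Algebra F Δ]
    [FiniteDimensional F Δ] {O : Subring F} (hO : ∀ a, a ∈ O ↔ ‖a‖ ≤ 1) (x : Δ) :
    IsIntegral O x ↔ algSpectralNorm F x ≤ 1 := by
  have hx : IsIntegral F x := Algebra.IsIntegral.isIntegral x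
  constructor
  · letI := spectralNormedDivisionRing F Δ
    haveI : IsUltrametricDist Δ := IsUltrametricDist.isUltrametricDist_of_forall_norm_add_le_max_norm
      (fun x y => algSpectralNorm_add_le_max (F := F) x y)
    change _ → ‖x‖ ≤ 1
    rintro ⟨p, hp, hpx⟩
    by_contra! hlt
    have hO1 : ∀ a : O, ‖algebraMap O Δ a‖ ≤ 1 := fun a => by
      have : algebraMap O Δ a = algebraMap F Δ a := rfl
      rw [this]
      exact (algSpectralNorm_algebraMap (a : F)).trans_le ((hO _).1 a.2)
    rw [Polynomial.eval₂_eq_sum_range, Finset.sum_range_succ, hp.coeff_natDegree, map_one, one_mul,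
      add_comm, add_eq_zero_iff_eq_neg] at hpx
    rcases Nat.eq_zero_or_pos p.natDegree with h0 | h0
    · rw [h0] at hpx; simp at hpx
    have h1 := congrArg norm hpx
    have h2 : ‖∑ i ∈ Finset.range p.natDegree, algebraMap O Δ (p.coeff i) * x ^ i‖ ≤
        ‖x‖ ^ (p.natDegree - 1) := by
      refine IsUltrametricDist.norm_sum_le_of_forall_le_of_nonneg (by positivity) fun i hi => ?_
      rw [norm_mul, norm_pow]
      have hi' := Finset.mem_range.1 hi
      exact (mul_le_of_le_one_left (by positivity) (hO1 _)).trans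
        (pow_le_pow_right₀ hlt.le (by omega))
    rw [norm_neg, norm_pow] at h1
    rw [← h1] at h2
    exact absurd h2 (not_le.2 (pow_lt_pow_right₀ hlt (by omega)))
  · intro h
    have hc := (spectralValue_le_one_iff (minpoly.monic hx)).1 h
    have hc' : ((minpoly F x).coeffs : Set F) ⊆ O := by
      intro a ha
      obtain ⟨n, -, rfl⟩ := Polynomial.mem_coeffs_iff.1 ha
      exact (hO _).2 (hc n)
    refine ⟨(minpoly F x).toSubring O hc', (Polynomial.monic_toSubring _ _ _).2 (minpoly.monic hx), ?_⟩
    have h1 := minpoly.aeval F x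
    rw [← Polynomial.map_toSubring (minpoly F x) O hc', Polynomial.aeval_def,
      Polynomial.eval₂_map] at h1
    exact h1

theorem exists_isNormalizedOrd_of_norm {Δ : Type*} [DivisionRing Δ] [Algebra F Δ]
    [FiniteDimensional F Δ] {O : Subring F} (hO : ∀ a, a ∈ O ↔ ‖a‖ ≤ 1) :
    ∃ w : Δ → ℤ, IsNormalizedOrd O w ∧ ∃ ζ ϖ N r, IsCyclicGenerator F w ζ ϖ N r := by
  have hint := isIntegral_iff_algSpectralNorm_le_one (Δ := Δ) hO
  letI := spectralNormedDivisionRing F Δ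
  haveI : IsUltrametricDist Δ := IsUltrametricDist.isUltrametricDist_of_forall_norm_add_le_max_norm
    (fun x y => algSpectralNorm_add_le_max (F := F) x y)
  letI : NormedAlgebra F Δ :=
    { ‹Algebra F Δ› with
      norm_smul_le := fun a x => by
        rw [Algebra.smul_def, norm_mul]
        exact (congrArg (· * ‖x‖) (algSpectralNorm_algebraMap a)).le }
  change ∀ x : Δ, IsIntegral O x ↔ ‖x‖ ≤ 1 at hint
  obtain ⟨ϖ₀, h0, h1, hmax⟩ := exists_norm_lt_one_max F Δ
  obtain ⟨ζ, N, hN, hζ, hN1, hgen⟩ := exists_teichmuller F Δ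
  obtain ⟨ϖ, r, hϖ, hr⟩ := exists_uniformizer_normalizing hN hζ hN1 hgen h0
  have hϖp : 0 < ‖ϖ‖ := by rw [hϖ]; exact norm_pos_iff.2 h0
  rw [← hϖ] at h1 hmax
  have hϖ0 := norm_pos_iff.1 hϖp
  have hw : ∀ x : Δ, ∃ n : ℤ, x ≠ 0 → ‖x‖ = ‖ϖ‖ ^ n := fun x => by
    by_cases hx : x = 0
    · exact ⟨0, fun h => absurd hx h⟩
    · obtain ⟨n, hn⟩ := exists_norm_eq_zpow hϖ0 h1 hmax hx
      exact ⟨n, fun _ => hn⟩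
  choose w hw using hw
  have hinj : ∀ {m n : ℤ}, ‖ϖ‖ ^ m ≤ ‖ϖ‖ ^ n ↔ n ≤ m := zpow_le_zpow_iff_right_of_lt_one₀ hϖp h1
  have hinj' : ∀ {m n : ℤ}, ‖ϖ‖ ^ m = ‖ϖ‖ ^ n → m = n := fun h =>
    le_antisymm (hinj.1 h.ge) (hinj.1 h.le)
  refine ⟨w, ⟨?_, ?_, ?_, ⟨ϖ, hϖ0, ?_⟩, ?_⟩, ζ, ϖ, N, r, hN, hζ, ?_, ?_, hϖ0, ?_, hr, ?_⟩
  · intro x y hx hy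
    apply hinj'
    rw [← hw _ (mul_ne_zero hx hy), norm_mul, hw x hx, hw y hy, zpow_add₀ hϖp.ne']
  · intro x y hx hy hxy
    have := IsUltrametricDist.norm_add_le_max x y
    rw [hw _ hxy, hw x hx, hw y hy, le_max_iff, hinj, hinj] at this
    exact min_le_iff.2 this
  · intro x hx
    rw [hint, hw x hx, ← hinj, zpow_zero]
  · apply hinj'
    rw [← hw _ hϖ0, zpow_one]
  · obtain ⟨ι, _, b, c, hbc⟩ := exists_basis_repr_norm_le F Δ
    classical
    by_cases hc : c = 0
    · exfalso
      have h2 := hbc 1 (by simp)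
      have h3 : b.repr 1 = 0 := by
        ext i; simpa [hc] using h2 i
      exact one_ne_zero (b.repr.map_eq_zero_iff.1 h3)
    refine ⟨Finset.univ.image fun i => c • b i, fun x hx => ?_⟩
    have h2 := hbc x ((hint x).1 hx)
    rw [← b.sum_repr x]
    refine Submodule.sum_mem _ fun i _ => ?_
    have h3 : c⁻¹ * b.repr x i ∈ O := by
      rw [hO, norm_mul, norm_inv, inv_mul_le_iff₀ (norm_pos_iff.2 hc), mul_one]
      exact h2 i
    have h4 : b.repr x i • b i = (⟨_, h3⟩ : O) • (c • b i) := by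
      change _ = (c⁻¹ * b.repr x i) • (c • b i)
      rw [smul_smul]
      congr 1
      field_simp
    rw [h4]
    exact Submodule.smul_mem _ _ (Submodule.subset_span (by simp))
  · intro h; rw [h] at hN1; simp at hN1
  · apply hinj'
    rw [← hw _ (by intro h; rw [h] at hN1; simp at hN1), hN1, zpow_zero]
  · apply hinj'
    rw [← hw _ hϖ0, zpow_one]
  · intro U hU
    -- The unit `x * ϖ ^ (-w x)` is congruent to some `ζ ^ i`, so `ζ ^ i * ϖ ^ w x` approximates `x`
    -- with an error of smaller norm.
    refine Submodule.eq_top_of_forall_norm_sub_lt U fun x hx => ?_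
    have h2 : ‖x * ϖ ^ (-w x)‖ = 1 := by
      rw [norm_mul, norm_zpow, hw x hx, ← zpow_add₀ hϖp.ne']; simp
    obtain ⟨i, hi⟩ := hgen _ h2
    refine ⟨_, hU i (w x), ?_⟩
    have h3 : x - ζ ^ i * ϖ ^ w x = (x * ϖ ^ (-w x) - ζ ^ i) * ϖ ^ w x := by
      rw [sub_mul, mul_assoc, ← zpow_add₀ hϖ0]; simp
    rw [h3, norm_mul, norm_zpow, ← hw x hx]
    exact mul_lt_of_lt_one_left (norm_pos_iff.2 hx) hi

end Normed

theorem exists_isNormalizedOrd (F : Type*) [Field F] [ValuativeRel F] [TopologicalSpace F]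
    [IsNonarchimedeanLocalField F] (Δ : Type*) [DivisionRing Δ] [Algebra F Δ]
    [FiniteDimensional F Δ] :
    ∃ w : Δ → ℤ, IsNormalizedOrd 𝒪[F] w ∧ ∃ ζ ϖ N r, IsCyclicGenerator F w ζ ϖ N r := by
  letI := IsTopologicalAddGroup.rightUniformSpace F
  haveI := isUniformAddGroup_of_addCommGroup (G := F)
  -- An embedding of the rank-one value group into the reals turns the valuation into an absolute
  -- value whose unit ball is still `𝒪[F]`.
  letI : (Valued.v (R := F)).RankOne :=
  { hom' := ValuativeRel.IsRankLeOne.nonempty.some.emb (R := F).comp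
      MonoidWithZeroHom.ValueGroup₀.embedding
    strictMono' := ValuativeRel.IsRankLeOne.nonempty.some.strictMono.comp
        MonoidWithZeroHom.ValueGroup₀.embedding_strictMono }
  open scoped Valued in
  have hp : ProperSpace F := .of_nontriviallyNormedField_of_weaklyLocallyCompactSpace F
  open scoped Valued in
  exact exists_isNormalizedOrd_of_norm (F := F) (Δ := Δ) (O := (ValuativeRel.valuation F).integer) fun a => by
    rw [Valued.toNormedField.norm_le_one_iff, IsValuativeTopology.v_eq_valuation]
    exact Iff.rfl

namespace IsNormalizedOrd

variable {F : Type*} [Field F] {O : Subring F} {Δ : Type*} [DivisionRing Δ] [Algebra F Δ]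
  {w : Δ → ℤ}

theorem map_one (hw : IsNormalizedOrd O w) : w 1 = 0 := by
  have := hw.map_mul 1 1 one_ne_zero one_ne_zero
  rw [mul_one] at this
  omega

theorem map_inv (hw : IsNormalizedOrd O w) {x : Δ} (hx : x ≠ 0) : w x⁻¹ = -w x := by
  have := hw.map_mul x x⁻¹ hx (inv_ne_zero hx)
  rw [mul_inv_cancel₀ hx, hw.map_one] at this
  omega

theorem map_pow (hw : IsNormalizedOrd O w) {x : Δ} (hx : x ≠ 0) (n : ℕ) : w (x ^ n) = n * w x := by
  induction n with
  | zero => simp [hw.map_one]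
  | succ n ih =>
    rw [pow_succ, hw.map_mul _ _ (pow_ne_zero _ hx) hx, ih]
    push_cast; ring

theorem map_zpow (hw : IsNormalizedOrd O w) {x : Δ} (hx : x ≠ 0) (n : ℤ) :
    w (x ^ n) = n * w x := by
  obtain ⟨m, rfl | rfl⟩ := n.eq_nat_or_neg
  · rw [zpow_natCast, hw.map_pow hx]
  · rw [zpow_neg, hw.map_inv (zpow_ne_zero _ hx), zpow_natCast, hw.map_pow hx]
    ring

end IsNormalizedOrd

/-! ### Averaging over conjugates by the generators -/

theorem geom_sum_eq_zero_of_pow_eq_one {Δ : Type*} [DivisionRing Δ] {η : Δ} {N : ℕ}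
    (h : η ^ N = 1) (h1 : η ≠ 1) : ∑ j ∈ Finset.range N, η ^ j = 0 := by
  have h2 := geom_sum_mul η N
  rw [h, sub_self] at h2
  exact (mul_eq_zero.1 h2).resolve_right (sub_ne_zero.2 h1)

namespace IsCyclicGenerator

variable {F : Type*} [Field F] {O : Subring F} {Δ : Type*} [DivisionRing Δ] [Algebra F Δ]
  {w : Δ → ℤ} {ζ ϖ : Δ} {N r : ℕ}

theorem root_ne_zero (h : IsCyclicGenerator F w ζ ϖ N r) : ζ ≠ 0 := by
  rintro rfl
  have := h.pow_eq_one
  rw [zero_pow h.pos.ne'] at this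
  exact zero_ne_one this

theorem pow_mul_root (h : IsCyclicGenerator F w ζ ϖ N r) (k : ℕ) :
    ϖ ^ k * ζ = ζ ^ r ^ k * ϖ ^ k := by
  have h1 : ∀ j : ℕ, ϖ * ζ ^ j = ζ ^ (r * j) * ϖ := by
    intro j
    induction j with
    | zero => simp
    | succ j ih =>
      rw [pow_succ, ← mul_assoc, ih, mul_assoc, h.mul_comm_pow, ← mul_assoc, ← pow_add, mul_add,
        mul_one]
  induction k with
  | zero => simp
  | succ k ih =>
    rw [pow_succ' ϖ, mul_assoc, ih, ← mul_assoc, h1, mul_assoc, pow_succ' r]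

/-- The powers of `r` repeat modulo `N`. The minimal `f` is the order of the automorphism that `ϖ`
induces on `⟨ζ⟩`; minimality is what makes the character sums in `sum_average_eq` vanish. -/
theorem exists_pow_commute (h : IsCyclicGenerator F w ζ ϖ N r) :
    ∃ f : ℕ, 0 < f ∧ Commute (ϖ ^ f) ζ ∧ ∀ i, 0 < i → i < f → ¬ Commute (ϖ ^ i) ζ := by
  classical
  have hex : ∃ f : ℕ, 0 < f ∧ Commute (ϖ ^ f) ζ := by
    haveI : NeZero N := ⟨h.pos.ne'⟩
    obtain ⟨a, b, hab, heq⟩ := Finite.exists_ne_map_eq_of_infinite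
      (fun k : ℕ => (⟨r ^ k % N, Nat.mod_lt _ h.pos⟩ : Fin N))
    wlog hlt : a < b generalizing a b
    · exact this b a hab.symm heq.symm (lt_of_le_of_ne (not_lt.1 hlt) hab.symm)
    have hz : ζ ^ r ^ a = ζ ^ r ^ b := by
      rw [pow_eq_pow_mod (r ^ a) h.pow_eq_one, pow_eq_pow_mod (r ^ b) h.pow_eq_one]
      congr 1
      simpa using heq
    refine ⟨b - a, by omega, ?_⟩
    have h1 := h.pow_mul_root b
    have hb : b = a + (b - a) := by omega
    rw [← hz, hb, pow_add, mul_assoc, ← mul_assoc (ζ ^ _), ← h.pow_mul_root a, mul_assoc] at h1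
    exact mul_left_cancel₀ (pow_ne_zero _ h.ne_zero) h1
  refine ⟨Nat.find hex, (Nat.find_spec hex).1, (Nat.find_spec hex).2, fun i h0 hi hc => ?_⟩
  exact Nat.find_min hex hi ⟨h0, hc⟩

variable {R : Type*} [Ring R] [Algebra F R]

theorem commute_map (h : IsCyclicGenerator F w ζ ϖ N r) (ρ : Δ →ₐ[F] R) {ψ : R}
    (h1 : Commute (ρ ζ) ψ) (h2 : Commute (ρ ϖ) ψ) (x : Δ) : Commute (ρ x) ψ := by
  let U : Submodule F Δ :=
    { carrier := {x | Commute (ρ x) ψ}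
      add_mem' := fun {a b} ha hb => by
        change Commute (ρ (a + b)) ψ
        rw [_root_.map_add]; exact ha.add_left hb
      zero_mem' := by
        change Commute (ρ 0) ψ
        rw [_root_.map_zero]; exact Commute.zero_left _
      smul_mem' := fun c a ha => by
        change Commute (ρ (c • a)) ψ
        rw [_root_.map_smul]; exact ha.smul_left c }
  have hinv : Commute (ρ ϖ⁻¹) ψ := by
    have e1 : ρ ϖ⁻¹ * ρ ϖ = 1 := by rw [← _root_.map_mul, inv_mul_cancel₀ h.ne_zero, _root_.map_one]
    have e2 : ρ ϖ * ρ ϖ⁻¹ = 1 := by rw [← _root_.map_mul, mul_inv_cancel₀ h.ne_zero, _root_.map_one]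
    calc ρ ϖ⁻¹ * ψ = ρ ϖ⁻¹ * ψ * (ρ ϖ * ρ ϖ⁻¹) := by rw [e2, mul_one]
      _ = ρ ϖ⁻¹ * (ψ * ρ ϖ) * ρ ϖ⁻¹ := by simp only [mul_assoc]
      _ = ρ ϖ⁻¹ * (ρ ϖ * ψ) * ρ ϖ⁻¹ := by rw [h2.eq]
      _ = (ρ ϖ⁻¹ * ρ ϖ) * ψ * ρ ϖ⁻¹ := by simp only [mul_assoc]
      _ = ψ * ρ ϖ⁻¹ := by rw [e1, one_mul]
  have hU : U = ⊤ := h.eq_top U fun i n => by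
    change Commute (ρ (ζ ^ i * ϖ ^ n)) ψ
    rw [_root_.map_mul, _root_.map_pow]
    refine (h1.pow_left i).mul_left ?_
    obtain ⟨m, rfl | rfl⟩ := n.eq_nat_or_neg
    · rw [zpow_natCast, _root_.map_pow]; exact h2.pow_left m
    · rw [zpow_neg, zpow_natCast, ← inv_pow, _root_.map_pow]; exact hinv.pow_left m
  have : x ∈ U := hU ▸ Submodule.mem_top
  exact this

/-- The sum of the conjugates of `φ` under the elements `ϖ ^ i * ζ ^ j`. -/
def average (ρ : Δ →ₐ[F] R) (ζ ϖ : Δ) (f N : ℕ) (φ : R) : R :=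
  ∑ i ∈ Finset.range f, ∑ j ∈ Finset.range N,
    ρ (ϖ ^ i * ζ ^ j) * φ * ρ ((ϖ ^ i * ζ ^ j)⁻¹)

/-- Conjugation by `ζ` or `ϖ` permutes the summands cyclically. The wrap-around is harmless for `ζ`
because `ζ ^ N = 1`, and for `ϖ` because `ϖ ^ f` is central, hence a scalar from `F` which cancels
against its inverse. -/
theorem commute_average (h : IsCyclicGenerator F w ζ ϖ N r)
    (hcenter : ∀ x : Δ, (∀ y, x * y = y * x) → ∃ a : F, x = algebraMap F Δ a)
    {f : ℕ} (hf : Commute (ϖ ^ f) ζ) (ρ : Δ →ₐ[F] R) (φ : R) (x : Δ) :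
    Commute (ρ x) (average ρ ζ ϖ f N φ) := by
  have hζ0 := h.root_ne_zero
  set T : R := ∑ j ∈ Finset.range N, ρ (ζ ^ j) * φ * ρ ((ζ ^ j)⁻¹) with hT
  have hTζ : Commute (ρ ζ) T := by
    have h1 := Finset.sum_range_succ_eq_of_eq (N := N)
      (fun j => ρ (ζ ^ j) * φ * ρ ((ζ ^ j)⁻¹)) (by simp [h.pow_eq_one])
    change ρ ζ * T = T * ρ ζ
    rw [hT]
    conv_rhs => rw [← h1]
    rw [Finset.mul_sum, Finset.sum_mul]
    refine Finset.sum_congr rfl fun j _ => ?_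
    rw [pow_succ' ζ j, mul_inv_rev, mul_assoc (ρ (ζ * ζ ^ j) * φ), ← _root_.map_mul,
      mul_assoc _ ζ⁻¹ ζ, inv_mul_cancel₀ hζ0, mul_one, _root_.map_mul]
    simp only [mul_assoc]
  have hav : average ρ ζ ϖ f N φ =
      ∑ i ∈ Finset.range f, ρ (ϖ ^ i) * T * ρ ((ϖ ^ i)⁻¹) := by
    unfold average
    refine Finset.sum_congr rfl fun i _ => ?_
    rw [hT, Finset.mul_sum, Finset.sum_mul]
    refine Finset.sum_congr rfl fun j _ => ?_
    rw [_root_.map_mul, mul_inv_rev, _root_.map_mul]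
    simp only [mul_assoc]
  refine h.commute_map ρ ?_ ?_ x
  · rw [hav]
    refine Commute.sum_right _ _ _ fun i hi => ?_
    have hi' := Finset.mem_range.1 hi
    have hϖi : ϖ ^ i ≠ 0 := pow_ne_zero _ h.ne_zero
    obtain ⟨s, hs⟩ : ∃ s : ℕ, ζ * ϖ ^ i = ϖ ^ i * ζ ^ s := by
      refine ⟨r ^ (f - i), ?_⟩
      have h1 : ϖ ^ f = ϖ ^ i * ϖ ^ (f - i) := by rw [← pow_add]; congr 1; omega
      have h2 : ϖ ^ f = ϖ ^ (f - i) * ϖ ^ i := by rw [← pow_add]; congr 1; omega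
      have h3 := hf.eq
      rw [h1, mul_assoc, h.pow_mul_root, ← h1, h2, ← mul_assoc, ← mul_assoc] at h3
      have h4 : ϖ ^ i * ζ ^ r ^ (f - i) * ϖ ^ (f - i) = ζ * ϖ ^ i * ϖ ^ (f - i) := by
        rw [h3, mul_assoc ζ, mul_assoc ζ, ← pow_add, ← pow_add, add_comm]
      exact (mul_right_cancel₀ (pow_ne_zero _ h.ne_zero) h4).symm
    have hs' : (ϖ ^ i)⁻¹ * ζ = ζ ^ s * (ϖ ^ i)⁻¹ := by
      rw [inv_mul_eq_iff_eq_mul₀ hϖi, ← mul_assoc, ← hs, mul_assoc, mul_inv_cancel₀ hϖi, mul_one]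
    change ρ ζ * _ = _ * ρ ζ
    rw [mul_assoc (ρ (ϖ ^ i) * T), ← _root_.map_mul, hs', ← mul_assoc, ← mul_assoc,
      ← _root_.map_mul, hs, _root_.map_mul, _root_.map_mul, _root_.map_pow ρ ζ s,
      mul_assoc (ρ (ϖ ^ i)), (hTζ.pow_left s).eq]
    simp only [mul_assoc]
  · rw [hav]
    obtain ⟨a, ha⟩ := hcenter (ϖ ^ f) fun y => by
      have := h.commute_map (AlgHom.id F Δ) (ψ := ϖ ^ f) hf.symm
        ((Commute.refl ϖ).pow_right f) y
      exact this.eq.symm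
    have h1 := Finset.sum_range_succ_eq_of_eq (N := f)
      (fun i => ρ (ϖ ^ i) * T * ρ ((ϖ ^ i)⁻¹)) (by
        have e : (algebraMap F Δ a) * (algebraMap F Δ a)⁻¹ = 1 := by
          rw [← ha]; exact mul_inv_cancel₀ (pow_ne_zero _ h.ne_zero)
        simp only [ha]
        rw [← map_inv₀ (algebraMap F Δ), AlgHom.commutes, AlgHom.commutes, mul_assoc,
          ← Algebra.commutes a⁻¹ T, ← mul_assoc, ← _root_.map_mul]
        have : a * a⁻¹ = 1 := by
          apply (algebraMap F Δ).injective
          rw [_root_.map_mul, map_inv₀, e, _root_.map_one]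
        simp [this])
    change ρ ϖ * _ = _ * ρ ϖ
    conv_rhs => rw [← h1]
    rw [Finset.mul_sum, Finset.sum_mul]
    refine Finset.sum_congr rfl fun j _ => ?_
    rw [pow_succ' ϖ j, mul_inv_rev, mul_assoc (ρ (ϖ * ϖ ^ j) * T), ← _root_.map_mul,
      mul_assoc _ ϖ⁻¹ ϖ, inv_mul_cancel₀ h.ne_zero, mul_one, _root_.map_mul]
    simp only [mul_assoc]

/-- Orthogonality of characters. After exchanging sums, the coefficient at `(i, j)` is the sum of
conjugates of `ϖ ^ i * ζ ^ j`. It vanishes for `i ≠ 0` and equals `N * τ j` for `i = 0`, with `τ j`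
central. Moving `τ j` past `φ` leaves `∑ τ j * (ζ ^ j)⁻¹ = N`, which supplies the second factor `N`.
-/
theorem sum_average_eq (h : IsCyclicGenerator F w ζ ϖ N r)
    (hcenter : ∀ x : Δ, (∀ y, x * y = y * x) → ∃ a : F, x = algebraMap F Δ a)
    {f : ℕ} (hf0 : 0 < f) (hf : Commute (ϖ ^ f) ζ)
    (hmin : ∀ i, 0 < i → i < f → ¬ Commute (ϖ ^ i) ζ) (ρ : Δ →ₐ[F] R) (φ : R) :
    ∑ k ∈ Finset.range f, ∑ m ∈ Finset.range N,
      ρ (ζ ^ m * ϖ ^ k) * average ρ ζ ϖ f N (ρ ((ζ ^ m * ϖ ^ k)⁻¹) * φ) =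
        ρ ((N : Δ) * N) * φ := by
  have hζ0 := h.root_ne_zero
  set z : ℕ → Δ := fun k => ϖ ^ k * ζ * (ϖ ^ k)⁻¹ with hz
  have hzpow : ∀ k, z k = ζ ^ r ^ k := fun k => by
    simp only [hz]
    rw [h.pow_mul_root, mul_assoc, mul_inv_cancel₀ (pow_ne_zero _ h.ne_zero), mul_one]
  have hzc : ∀ k, Commute (z k) ζ := fun k => by
    rw [hzpow]; exact (Commute.refl ζ).pow_left _
  have hconj : ∀ k j, ϖ ^ k * ζ ^ j * (ϖ ^ k)⁻¹ = z k ^ j := by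
    intro k j
    induction j with
    | zero => simp [h.ne_zero]
    | succ j ih =>
      rw [pow_succ (z k), ← ih, pow_succ ζ]
      simp only [hz, mul_assoc]
      rw [inv_mul_cancel_left₀ (pow_ne_zero _ h.ne_zero)]
  have hz1 : ∀ k, 0 < k → k < f → z k ≠ ζ := by
    intro k h0 hk he
    refine hmin k h0 hk ?_
    simp only [hz] at he
    exact (mul_inv_eq_iff_eq_mul₀ (pow_ne_zero _ h.ne_zero)).1 he
  have hzN : ∀ k, z k ^ N = 1 := fun k => by
    rw [hzpow, ← pow_mul, mul_comm, pow_mul, h.pow_eq_one, one_pow]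
  set τ : ℕ → Δ := fun j => ∑ k ∈ Finset.range f, z k ^ j with hτ
  have hτc : ∀ j x, Commute x (τ j) := by
    intro j x
    refine h.commute_map (AlgHom.id F Δ) ?_ ?_ x
    · exact Commute.sum_right _ _ _ fun k _ => ((hzc k).symm.pow_right j)
    · have h1 := Finset.sum_range_succ_eq_of_eq (N := f) (fun k => z k ^ j) (by
        have : z f = ζ := by
          simp only [hz]
          rw [hf.eq, mul_assoc, mul_inv_cancel₀ (pow_ne_zero _ h.ne_zero), mul_one]
        change z f ^ j = z 0 ^ j
        rw [this]; simp [hz])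
      change ϖ * τ j = τ j * ϖ
      simp only [hτ]
      conv_rhs => rw [← h1]
      rw [Finset.mul_sum, Finset.sum_mul]
      refine Finset.sum_congr rfl fun k _ => ?_
      rw [← hconj, ← hconj, pow_succ' ϖ k, mul_inv_rev]
      simp only [mul_assoc]
      rw [inv_mul_cancel₀ h.ne_zero, mul_one]
  -- For `k ≠ 0` the element `z k * ζ⁻¹` is a nontrivial `N`-th root of unity by minimality of `f`,
  -- so only `k = 0` contributes.
  have hτsum : ∑ j ∈ Finset.range N, τ j * (ζ ^ j)⁻¹ = N := by
    simp only [hτ, Finset.sum_mul]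
    rw [Finset.sum_comm, Finset.sum_eq_single_of_mem 0 (Finset.mem_range.2 hf0)]
    · have : ∀ j ∈ Finset.range N, z 0 ^ j * (ζ ^ j)⁻¹ = 1 := fun j _ => by
        simp only [hz, pow_zero, one_mul, inv_one, mul_one]
        exact mul_inv_cancel₀ (pow_ne_zero _ hζ0)
      rw [Finset.sum_congr rfl this]; simp
    · intro k hk hk0
      have h2 : ∀ j ∈ Finset.range N, z k ^ j * (ζ ^ j)⁻¹ = (z k * ζ⁻¹) ^ j := fun j _ => by
        rw [((hzc k).inv_right₀).mul_pow, inv_pow]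
      rw [Finset.sum_congr rfl h2]
      refine geom_sum_eq_zero_of_pow_eq_one ?_ ?_
      · rw [((hzc k).inv_right₀).mul_pow, inv_pow, hzN, h.pow_eq_one]; simp
      · intro he
        exact hz1 k (Nat.pos_of_ne_zero hk0) (Finset.mem_range.1 hk)
          ((mul_inv_eq_one₀ hζ0).1 he)
  have hcoef : ∀ i < f, ∀ j, (∑ k ∈ Finset.range f, ∑ m ∈ Finset.range N,
      ζ ^ m * ϖ ^ k * (ϖ ^ i * ζ ^ j) * (ζ ^ m * ϖ ^ k)⁻¹) = if i = 0 then (N : Δ) * τ j else 0 := by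
    intro i hi j
    have hϖi : ϖ ^ i ≠ 0 := pow_ne_zero _ h.ne_zero
    set y := (ϖ ^ i)⁻¹ * ζ * ϖ ^ i with hy
    have hypow : ∀ m : ℕ, ζ ^ m * ϖ ^ i = ϖ ^ i * y ^ m := by
      intro m
      induction m with
      | zero => simp
      | succ m ih =>
        rw [pow_succ y, ← mul_assoc, ← ih, hy, pow_succ]
        simp only [mul_assoc]
        rw [mul_inv_cancel_left₀ hϖi]
    have hyc : Commute y ζ := by
      have h1 := (hzc i).eq
      simp only [hz] at h1
      change y * ζ = ζ * y
      apply mul_left_cancel₀ hϖi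
      apply mul_right_cancel₀ (inv_ne_zero hϖi)
      simp only [hy, mul_assoc] at h1 ⊢
      rw [mul_inv_cancel_left₀ hϖi, mul_inv_cancel₀ hϖi, mul_one, ← h1]
    have hterm : ∀ k m : ℕ, ζ ^ m * ϖ ^ k * (ϖ ^ i * ζ ^ j) * (ζ ^ m * ϖ ^ k)⁻¹ =
        ϖ ^ i * ((y * ζ⁻¹) ^ m * z k ^ j) := by
      intro k m
      have e1 : ϖ ^ k * ϖ ^ i = ϖ ^ i * ϖ ^ k := by rw [← pow_add, ← pow_add, add_comm]
      have e2 : z k ^ j * (ζ ^ m)⁻¹ = (ζ ^ m)⁻¹ * z k ^ j :=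
        (((hzc k).pow_pow j m).inv_right₀).eq
      rw [(hyc.inv_right₀).mul_pow, inv_pow, mul_assoc (y ^ m), ← e2, ← hconj, mul_inv_rev]
      calc _ = ζ ^ m * (ϖ ^ k * ϖ ^ i) * ζ ^ j * ((ϖ ^ k)⁻¹ * (ζ ^ m)⁻¹) := by
            simp only [mul_assoc]
        _ = (ζ ^ m * ϖ ^ i) * ϖ ^ k * ζ ^ j * ((ϖ ^ k)⁻¹ * (ζ ^ m)⁻¹) := by
            rw [e1]; simp only [mul_assoc]
        _ = _ := by rw [hypow]; simp only [mul_assoc]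
    simp only [hterm, ← Finset.mul_sum, ← Finset.sum_mul]
    split_ifs with hi0
    · subst hi0
      have : y * ζ⁻¹ = 1 := by simp [hy, hζ0]
      simp [this, hτ]
    · have h1 : ∑ m ∈ Finset.range N, (y * ζ⁻¹) ^ m = 0 := by
        refine geom_sum_eq_zero_of_pow_eq_one ?_ ?_
        · have h3 := hypow N
          rw [h.pow_eq_one, one_mul, eq_comm, mul_eq_left₀ hϖi] at h3
          rw [(hyc.inv_right₀).mul_pow, inv_pow, h3, h.pow_eq_one]; simp
        · intro he
          have h3 := (mul_inv_eq_one₀ hζ0).1 he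
          refine hmin i (Nat.pos_of_ne_zero hi0) hi ?_
          have h4 := hypow 1
          rw [pow_one, pow_one, h3] at h4
          exact h4.symm
      rw [h1]; simp
  have hswap : ∑ k ∈ Finset.range f, ∑ m ∈ Finset.range N,
      ρ (ζ ^ m * ϖ ^ k) * average ρ ζ ϖ f N (ρ ((ζ ^ m * ϖ ^ k)⁻¹) * φ) =
      ∑ i ∈ Finset.range f, ∑ j ∈ Finset.range N,
        ρ (∑ k ∈ Finset.range f, ∑ m ∈ Finset.range N,
          ζ ^ m * ϖ ^ k * (ϖ ^ i * ζ ^ j) * (ζ ^ m * ϖ ^ k)⁻¹) * φ * ρ ((ϖ ^ i * ζ ^ j)⁻¹) := by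
    have hg : ∀ g : ℕ → ℕ → ℕ → ℕ → R,
        ∑ k ∈ Finset.range f, ∑ m ∈ Finset.range N, ∑ i ∈ Finset.range f, ∑ j ∈ Finset.range N,
          g k m i j = ∑ i ∈ Finset.range f, ∑ j ∈ Finset.range N, ∑ k ∈ Finset.range f,
            ∑ m ∈ Finset.range N, g k m i j := by
      intro g
      rw [Finset.sum_congr rfl fun k _ => Finset.sum_comm, Finset.sum_comm]
      refine Finset.sum_congr rfl fun i _ => ?_
      rw [Finset.sum_congr rfl fun k _ => Finset.sum_comm, Finset.sum_comm]
    simp only [average, Finset.mul_sum, map_sum, Finset.sum_mul]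
    rw [hg]
    refine Finset.sum_congr rfl fun i _ => Finset.sum_congr rfl fun j _ =>
      Finset.sum_congr rfl fun k _ => Finset.sum_congr rfl fun m _ => ?_
    simp only [_root_.map_mul, mul_assoc]
  rw [hswap, Finset.sum_eq_single_of_mem 0 (Finset.mem_range.2 hf0)]
  · have hτφ : ∀ j, Commute (ρ (τ j)) φ := by
      intro j
      obtain ⟨a, ha⟩ := hcenter (τ j) fun y => (hτc j y).eq.symm
      rw [ha, AlgHom.commutes]
      exact Algebra.commutes a φ
    have h1 : ∀ j ∈ Finset.range N,
        ρ (∑ k ∈ Finset.range f, ∑ m ∈ Finset.range N,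
          ζ ^ m * ϖ ^ k * (ϖ ^ 0 * ζ ^ j) * (ζ ^ m * ϖ ^ k)⁻¹) * φ * ρ ((ϖ ^ 0 * ζ ^ j)⁻¹) =
        ρ N * φ * ρ (τ j * (ζ ^ j)⁻¹) := by
      intro j _
      rw [hcoef 0 hf0 j, if_pos rfl, pow_zero, one_mul, _root_.map_mul, _root_.map_mul,
        mul_assoc (ρ N), (hτφ j).eq]
      simp only [mul_assoc]
    rw [Finset.sum_congr rfl h1, ← Finset.mul_sum, ← map_sum, hτsum, _root_.map_mul,
      _root_.map_natCast, mul_assoc, ← (Nat.cast_commute N φ).eq, ← mul_assoc]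
  · intro i hi hi0
    refine Finset.sum_eq_zero fun j _ => ?_
    rw [hcoef i (Finset.mem_range.1 hi) j, if_neg hi0]
    simp

/-- An endomorphism which commutes with the centre of `Δ` is a combination of elements of the
commutant of `Δ`, with control of the valuations of the coefficients. -/
theorem exists_decomposition (h : IsCyclicGenerator F w ζ ϖ N r) (hw : IsNormalizedOrd O w)
    (hcenter : ∀ x : Δ, (∀ y, x * y = y * x) → ∃ a : F, x = algebraMap F Δ a)
    (ρ : Δ →ₐ[F] R) (φ : R) :
    ∃ (T : Finset (ℕ × ℕ)) (d : ℕ × ℕ → Δ) (b : ℕ × ℕ → R),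
      φ = ∑ t ∈ T, ρ (d t) * b t ∧ ∀ t, d t ≠ 0 ∧ (∀ x, Commute (ρ x) (b t)) ∧
        b t ∈ AddSubgroup.closure
          {ψ | ∃ u v, u ≠ 0 ∧ v ≠ 0 ∧ w u + w v = -w (d t) ∧ ψ = ρ u * φ * ρ v} := by
  obtain ⟨f, hf0, hf, hmin⟩ := h.exists_pow_commute
  have hN := h.natCast_ne_zero
  have hζ0 := h.root_ne_zero
  have hne : ∀ i j : ℕ, ζ ^ i * ϖ ^ j ≠ 0 := fun i j =>
    mul_ne_zero (pow_ne_zero _ hζ0) (pow_ne_zero _ h.ne_zero)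
  have hne' : ∀ i j : ℕ, ϖ ^ i * ζ ^ j ≠ 0 := fun i j =>
    mul_ne_zero (pow_ne_zero _ h.ne_zero) (pow_ne_zero _ hζ0)
  have hNN : ((N : Δ) * N)⁻¹ ≠ 0 := inv_ne_zero (mul_ne_zero hN hN)
  have hwN : w ((N : Δ) * N)⁻¹ = 0 := by
    rw [hw.map_inv (mul_ne_zero hN hN), hw.map_mul _ _ hN hN, h.map_natCast]; rfl
  -- Dividing by `N * N` costs nothing, as `N` has valuation zero.
  refine ⟨Finset.range f ×ˢ Finset.range N, fun t => ((N : Δ) * N)⁻¹ * (ζ ^ t.2 * ϖ ^ t.1),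
    fun t => average ρ ζ ϖ f N (ρ ((ζ ^ t.2 * ϖ ^ t.1)⁻¹) * φ), ?_, fun t => ⟨?_, ?_, ?_⟩⟩
  · rw [Finset.sum_product]
    simp only [_root_.map_mul ρ ((N : Δ) * N)⁻¹, mul_assoc (ρ ((N : Δ) * N)⁻¹), ← Finset.mul_sum]
    rw [h.sum_average_eq hcenter hf0 hf hmin, ← mul_assoc, ← _root_.map_mul,
      inv_mul_cancel₀ (mul_ne_zero hN hN), _root_.map_one, one_mul]
  · exact mul_ne_zero hNN (hne _ _)
  · exact h.commute_average hcenter hf ρ _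
  · refine AddSubgroup.sum_mem _ fun i _ => AddSubgroup.sum_mem _ fun j _ => ?_
    refine AddSubgroup.subset_closure ⟨ϖ ^ i * ζ ^ j * (ζ ^ t.2 * ϖ ^ t.1)⁻¹,
      (ϖ ^ i * ζ ^ j)⁻¹, mul_ne_zero (hne' _ _) (inv_ne_zero (hne _ _)),
      inv_ne_zero (hne' _ _), ?_, ?_⟩
    · rw [hw.map_mul _ _ (hne' _ _) (inv_ne_zero (hne _ _)), hw.map_inv (hne' _ _),
        hw.map_mul _ _ hNN (hne _ _), hw.map_inv (hne _ _), hwN]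
      ring
    · rw [_root_.map_mul ρ (ϖ ^ i * ζ ^ j) (ζ ^ t.2 * ϖ ^ t.1)⁻¹]
      simp only [mul_assoc]

end IsCyclicGenerator

/-- Take `W` maximal such that no element of `x + W` has order above that of `x`. If `W` and `x` did
not span, a vector outside, corrected by an element of the span so as to have the largest order,
could be added to `W`. So `W` is an orthogonal complement of the line of `x`, and the map killing
`W` and sending `x` to `y` works. -/
theorem exists_linearMap_map_eq_of_ord {Δ V : Type*} [DivisionRing Δ] [AddCommGroup V] [Module Δ V]
    [FiniteDimensional Δ V] (α : V → ℤ) (n : Δ → ℤ)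
    (hsmul : ∀ l v, l ≠ 0 → v ≠ 0 → α (l • v) = α v + n l)
    (hadd : ∀ u v, u ≠ 0 → v ≠ 0 → u + v ≠ 0 → min (α u) (α v) ≤ α (u + v))
    (hbdd : ∀ (U : Submodule Δ V) (z : V), z ∉ U → ∃ C, ∀ u ∈ U, α (z - u) ≤ C)
    {x : V} (hx : x ≠ 0) (y : V) :
    ∃ φ : V →ₗ[Δ] V, φ x = y ∧ ∀ z, φ z ≠ 0 → α z + α y - α x ≤ α (φ z) := by
  have hneg : ∀ v, v ≠ 0 → α (-v) = α v := by
    intro v hv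
    have h1 := hsmul (-1) v (by simp) hv
    have h2 := hsmul (-1) (-v) (by simp) (by simpa using hv)
    simp only [neg_smul, one_smul, neg_neg] at h1 h2
    omega
  have hstrict : ∀ u v, u ≠ 0 → v ≠ 0 → α u < α v → α (u + v) = α u := by
    intro u v hu hv h
    have huv : u + v ≠ 0 := by
      intro h0
      rw [eq_neg_of_add_eq_zero_left h0, hneg v hv] at h
      exact lt_irrefl _ h
    have h1 := hadd u v hu hv huv
    have h2 := hadd (u + v) (-v) huv (by simpa using hv) (by simpa using hu)
    rw [hneg v hv, add_neg_cancel_right] at h2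
    omega
  let S : Set (Submodule Δ V) := {W | ∀ w ∈ W, x + w ≠ 0 ∧ α (x + w) ≤ α x}
  obtain ⟨W, hW, hWmax⟩ := (wellFounded_gt (α := Submodule Δ V)).has_min S
    ⟨⊥, fun w hw => by rw [(Submodule.mem_bot Δ).1 hw, add_zero]; exact ⟨hx, le_rfl⟩⟩
  have hxW : x ∉ W := fun h => (hW (-x) (W.neg_mem h)).1 (add_neg_cancel x)
  have htop : W ⊔ Submodule.span Δ {x} = ⊤ := by
    by_contra hne
    obtain ⟨z, -, hz⟩ := SetLike.exists_of_lt (lt_top_iff_ne_top.2 hne)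
    set U := W ⊔ Submodule.span Δ {x} with hU
    have hWU : W ≤ U := le_sup_left
    have hxU : x ∈ U := Submodule.mem_sup_right (Submodule.mem_span_singleton_self x)
    obtain ⟨C, hC⟩ := hbdd U z hz
    obtain ⟨M, ⟨u, hu, rfl⟩, hM⟩ := Int.exists_greatest_of_bdd
      (P := fun m => ∃ u ∈ U, α (z - u) = m) ⟨C, fun m ⟨u, hu, h⟩ => h ▸ hC u hu⟩
      ⟨_, 0, U.zero_mem, rfl⟩
    have hz' : z - u ∉ U := fun h => hz (by simpa using U.add_mem h hu)
    have hz0 : z - u ≠ 0 := fun h => hz' (h ▸ U.zero_mem)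
    refine hWmax (W ⊔ Submodule.span Δ {z - u}) ?_ ?_
    · intro w' hw'
      obtain ⟨w, hw, t, ht, rfl⟩ := Submodule.mem_sup.1 hw'
      obtain ⟨μ, rfl⟩ := Submodule.mem_span_singleton.1 ht
      by_cases hμ : μ = 0
      · simpa [hμ] using hW w hw
      have hxw : x + w ∈ U := U.add_mem hxU (hWU hw)
      have hs : x + (w + μ • (z - u)) = x + w + μ • (z - u) := (add_assoc _ _ _).symm
      rw [hs]
      have hs0 : x + w + μ • (z - u) ≠ 0 := by
        intro h0
        have h1 : μ • (z - u) ∈ U := by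
          rw [eq_neg_of_add_eq_zero_right h0]; exact U.neg_mem hxw
        exact hz' ((U.smul_mem_iff hμ).1 h1)
      refine ⟨hs0, ?_⟩
      -- By the maximal choice of `u`, the sum has order at most that of `μ • (z - u)`. The latter
      -- would then exceed `α x ≥ α (x + w)`, forcing the sum to have the order of `x + w`.
      by_contra! hlt
      have h1 : x + w + μ • (z - u) = μ • (z - (u - μ⁻¹ • (x + w))) := by
        rw [smul_sub, smul_sub, smul_sub, smul_inv_smul₀ hμ]; abel
      have hv0 : z - (u - μ⁻¹ • (x + w)) ≠ 0 := by
        intro h0; rw [h0, smul_zero] at h1; exact hs0 h1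
      have h2 := hM _ ⟨u - μ⁻¹ • (x + w), U.sub_mem hu (U.smul_mem _ hxw), rfl⟩
      have h3 := hsmul μ _ hμ hv0
      have h4 := hsmul μ _ hμ hz0
      rw [← h1] at h3
      obtain ⟨h5, h6⟩ := hW w hw
      have h7 := hstrict (x + w) (μ • (z - u)) h5 (smul_ne_zero hμ hz0) (by omega)
      omega
    · refine lt_of_le_of_ne le_sup_left fun h => hz' (hWU ?_)
      rw [h]
      exact Submodule.mem_sup_right (Submodule.mem_span_singleton_self _)
  obtain ⟨f, hfx, hf⟩ := Submodule.exists_le_ker_of_notMem hxW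
  refine ⟨(LinearMap.toSpanSingleton Δ V ((f x)⁻¹ • y)).comp f, ?_, fun z hz => ?_⟩
  · simp [smul_smul, hfx]
  · have hzt : z ∈ W ⊔ Submodule.span Δ {x} := htop ▸ Submodule.mem_top
    obtain ⟨w, hw, t, ht, rfl⟩ := Submodule.mem_sup.1 hzt
    obtain ⟨l, rfl⟩ := Submodule.mem_span_singleton.1 ht
    have hfw : f w = 0 := hf hw
    have hval : ((LinearMap.toSpanSingleton Δ V ((f x)⁻¹ • y)).comp f) (w + l • x) = l • y := by
      simp [hfw, smul_smul, hfx]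
    rw [hval] at hz ⊢
    have hl : l ≠ 0 := fun h => hz (by rw [h, zero_smul])
    have hy : y ≠ 0 := fun h => hz (by rw [h, smul_zero])
    have h1 : w + l • x = l • (x + l⁻¹ • w) := by
      rw [smul_add, smul_inv_smul₀ hl, add_comm]
    obtain ⟨h2, h3⟩ := hW (l⁻¹ • w) (W.smul_mem _ hw)
    rw [h1, hsmul l _ hl h2, hsmul l _ hl hy]
    omega

/-! ### The order function of a lattice sequence -/

section Ord

variable {F : Type*} [Field F] [ValuativeRel F] [TopologicalSpace F] [IsNonarchimedeanLocalField F]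
  {A : Type*} [Ring A] [Algebra F A]
  {V : Type*} [AddCommGroup V] [Module F V] [Module A V] [IsScalarTower F A V]

theorem Module.End.finiteDimensional_of_isScalarTower (F A V : Type*) [Field F] [Ring A]
    [Algebra F A] [AddCommGroup V] [Module F V] [Module A V] [IsScalarTower F A V]
    [FiniteDimensional F V] : FiniteDimensional F (Module.End A V) :=
  FiniteDimensional.of_injective (LinearMap.restrictScalarsₗ F A V V F)
    (LinearMap.restrictScalars_injective F)

variable (F A V) in
theorem exists_isNormalizedOrd_end [IsSimpleModule A V] [FiniteDimensional F V] :
    ∃ w : Module.End A V → ℤ, IsNormalizedOrd 𝒪[F] w := by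
  classical
  haveI : FiniteDimensional F (Module.End A V) := Module.End.finiteDimensional_of_isScalarTower F A V
  obtain ⟨w, hw, -⟩ := exists_isNormalizedOrd F (Module.End A V)
  exact ⟨w, hw⟩

theorem Module.End.exists_mul_eq_one [IsSimpleModule A V] {δ : Module.End A V} (h : δ ≠ 0) :
    ∃ ε : Module.End A V, δ * ε = 1 ∧ ε * δ = 1 := by
  classical
  exact ⟨δ⁻¹, mul_inv_cancel₀ h, inv_mul_cancel₀ h⟩

theorem isIntegral_algebraMap_integer_iff (Δ : Type*) [Ring Δ] [Nontrivial Δ] [Algebra F Δ] (a : F) :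
    IsIntegral 𝒪[F] (algebraMap F Δ a) ↔ a ∈ 𝒪[F] := by
  have h1 : IsIntegral 𝒪[F] (algebraMap F Δ a) ↔ IsIntegral 𝒪[F] a :=
    isIntegral_algHom_iff (IsScalarTower.toAlgHom 𝒪[F] F Δ) (algebraMap F Δ).injective
  rw [h1]
  refine ⟨fun h => (Valuation.integer.integers (ValuativeRel.valuation F)).mem_of_integral h,
    fun h => ?_⟩
  exact isIntegral_algebraMap (x := (⟨a, h⟩ : 𝒪[F]))

/-- An endomorphism of `V` as an `A`-module, seen as an `F`-linear endomorphism. -/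
def Module.End.toEndBase (F : Type*) {A V : Type*} [Field F] [Ring A] [Algebra F A]
    [AddCommGroup V] [Module F V] [Module A V] [IsScalarTower F A V] :
    Module.End A V →ₐ[F] Module.End F V where
  toFun := LinearMap.restrictScalars F
  map_one' := rfl
  map_mul' _ _ := rfl
  map_zero' := rfl
  map_add' _ _ := rfl
  commutes' a := by ext v; simp [Module.algebraMap_end_apply]

theorem Module.End.exists_mul_eq_one_of_isNormalizedOrd [IsSimpleModule A V]
    {w : Module.End A V → ℤ} (hw : IsNormalizedOrd 𝒪[F] w) {δ : Module.End A V} (h : δ ≠ 0) :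
    ∃ ε : Module.End A V, ε ≠ 0 ∧ δ * ε = 1 ∧ ε * δ = 1 ∧ w ε = -w δ := by
  haveI : Nontrivial V := IsSimpleModule.nontrivial A V
  obtain ⟨ε, h1, h2⟩ := Module.End.exists_mul_eq_one h
  have hε : ε ≠ 0 := by rintro rfl; simp at h1
  refine ⟨ε, hε, h1, h2, ?_⟩
  have h3 := hw.map_mul δ ε h hε
  have h4 := hw.map_mul 1 1 one_ne_zero one_ne_zero
  rw [h1] at h3
  rw [mul_one] at h4
  omega

theorem map_uniformizer_pos [IsSimpleModule A V] {w : Module.End A V → ℤ}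
    (hw : IsNormalizedOrd 𝒪[F] w) {π : 𝒪[F]} (hπ : Irreducible π) :
    0 < w (algebraMap F (Module.End A V) π) := by
  haveI : Nontrivial V := IsSimpleModule.nontrivial A V
  have hπ0 : (π : F) ≠ 0 := fun h => hπ.ne_zero (Subtype.ext h)
  have hπ1 : algebraMap F (Module.End A V) π ≠ 0 := by simpa using hπ0
  by_contra! hle
  have hinv : algebraMap F (Module.End A V) (π : F)⁻¹ ≠ 0 := by simpa using hπ0
  have h1 := hw.map_mul _ _ hπ1 hinv
  have h2 := hw.map_mul 1 1 one_ne_zero one_ne_zero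
  rw [← map_mul, mul_inv_cancel₀ hπ0, map_one] at h1
  rw [mul_one] at h2
  have h3 := (hw.isIntegral_iff _ hinv).2 (by omega)
  rw [isIntegral_algebraMap_integer_iff] at h3
  refine hπ.not_isUnit (IsUnit.of_mul_eq_one ⟨_, h3⟩ (Subtype.ext ?_))
  exact mul_inv_cancel₀ hπ0

theorem mem_maxIdealD_iff [IsSimpleModule A V] {w : Module.End A V → ℤ}
    (hw : IsNormalizedOrd 𝒪[F] w) {δ : Module.End A V} (h : δ ≠ 0) :
    δ ∈ maxIdealD F A V ↔ 1 ≤ w δ := by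
  obtain ⟨ε, hε, h1, h2, h3⟩ := Module.End.exists_mul_eq_one_of_isNormalizedOrd hw h
  constructor
  · rintro ⟨hδ, hno⟩
    have h5 := (hw.isIntegral_iff δ h).1 hδ
    by_contra! hlt
    exact hno ⟨ε, (hw.isIntegral_iff ε hε).2 (by omega), h1, h2⟩
  · intro h4
    refine ⟨(hw.isIntegral_iff δ h).2 (by omega), ?_⟩
    rintro ⟨ε', hε', h1', h2'⟩
    have : ε' = ε := by
      calc ε' = ε * δ * ε' := by rw [h2, one_mul]
        _ = ε := by rw [mul_assoc, h1', mul_one]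
    rw [this] at hε'
    have := (hw.isIntegral_iff ε hε).1 hε'
    omega

namespace LatticeSeq

variable [IsSimpleModule A V] {w : Module.End A V → ℤ}

/-- Any element of valuation one generates `𝔭_D`, so it carries `Λ_k` onto `Λ_{k+e}`, and elements
of valuation zero preserve each lattice. The general case follows by induction on the valuation. -/
theorem exists_forall_apply_mem_iff (Λ : LatticeSeq F A V) (hw : IsNormalizedOrd 𝒪[F] w) :
    ∃ e : ℤ, 1 ≤ e ∧ ∀ δ : Module.End A V, δ ≠ 0 → ∀ k v,
      δ v ∈ Λ.lat (k + e * w δ) ↔ v ∈ Λ.lat k := by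
  haveI : Nontrivial V := IsSimpleModule.nontrivial A V
  obtain ⟨e, he, hper⟩ := Λ.exists_period
  have hmul0 : ∀ {δ ε : Module.End A V}, δ ≠ 0 → ε ≠ 0 → δ * ε ≠ 0 := by
    classical
    exact fun h1 h2 => mul_ne_zero h1 h2
  have hstab : ∀ δ : Module.End A V, δ ≠ 0 → 0 ≤ w δ → ∀ k v, v ∈ Λ.lat k → δ v ∈ Λ.lat k :=
    fun δ h0 h k v hv => (Λ.isLattice k).stable δ ((hw.isIntegral_iff δ h0).2 h) v hv
  have hone : ∀ δ : Module.End A V, δ ≠ 0 → w δ = 1 → ∀ k v,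
      δ v ∈ Λ.lat (k + e) ↔ v ∈ Λ.lat k := by
    intro δ h0 h k v
    obtain ⟨ε, hε, h1, h2, h3⟩ := Module.End.exists_mul_eq_one_of_isNormalizedOrd hw h0
    rw [hper k]
    constructor
    · intro hv
      have hall : ∀ u ∈ mulMaxIdealD A (Λ.lat k), ε u ∈ Λ.lat k := by
        intro u hu
        induction hu using Submodule.span_induction with
        | mem u hu =>
          obtain ⟨δ', hδ', v', hv', rfl⟩ := hu
          by_cases hz : δ' = 0
          · simp [hz]
          have hge := (mem_maxIdealD_iff hw hz).1 hδ'
          refine hstab (ε * δ') (hmul0 hε hz) ?_ k v' hv'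
          rw [hw.map_mul _ _ hε hz]; omega
        | zero => simp
        | add a b _ _ ha hb => rw [map_add]; exact add_mem ha hb
        | smul c a _ ha =>
          have : ε (c • a) = c • ε a := by
            have := ((Module.End.toEndBase F ε).restrictScalars 𝒪[F]).map_smul c a
            exact this
          rw [this]; exact Submodule.smul_mem _ _ ha
      have := hall _ hv
      rwa [← Module.End.mul_apply, h2] at this
    · intro hv
      exact Submodule.subset_span ⟨δ, (mem_maxIdealD_iff hw h0).2 h.ge, v, hv, rfl⟩
  obtain ⟨ϖ, hϖ0, hϖ1⟩ := hw.exists_eq_one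
  obtain ⟨ϖ', hϖ'0, h1, h2, h3⟩ := Module.End.exists_mul_eq_one_of_isNormalizedOrd hw hϖ0
  have key : ∀ n : ℤ, ∀ δ : Module.End A V, δ ≠ 0 → w δ = n → ∀ k v,
      δ v ∈ Λ.lat (k + e * n) ↔ v ∈ Λ.lat k := by
    intro n
    induction n using Int.induction_on with
    | zero =>
      intro δ h0 h k v
      rw [mul_zero, add_zero]
      refine ⟨fun hv => ?_, hstab δ h0 h.ge k v⟩
      obtain ⟨ε, hε, h4, h5, h6⟩ := Module.End.exists_mul_eq_one_of_isNormalizedOrd hw h0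
      have := hstab ε hε (by omega) k _ hv
      rwa [← Module.End.mul_apply, h5] at this
    | succ n ih =>
      intro δ h0 h k v
      have h4 : δ v = ϖ ((ϖ' * δ) v) := by
        rw [← Module.End.mul_apply, ← mul_assoc, h1, one_mul]
      rw [h4, mul_add, mul_one, ← add_assoc, hone ϖ hϖ0 hϖ1]
      refine ih _ (hmul0 hϖ'0 h0) ?_ k v
      rw [hw.map_mul _ _ hϖ'0 h0]; omega
    | pred n ih =>
      intro δ h0 h k v
      rw [← hone ϖ hϖ0 hϖ1, ← Module.End.mul_apply, mul_sub, mul_one, add_assoc, sub_add_cancel]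
      refine ih _ (hmul0 hϖ0 h0) ?_ k v
      rw [hw.map_mul _ _ hϖ0 h0]; omega
  exact ⟨e, he, fun δ h0 k v => key _ δ h0 rfl k v⟩

/-- Krull's intersection theorem in `V ⧸ U`: otherwise the image of `z` would be divisible by all
powers of `π` in the finitely generated image of `Λ_0`. This is the boundedness needed for
orthogonal complements. -/
theorem exists_forall_sub_notMem (Λ : LatticeSeq F A V) [FiniteDimensional F V]
    (U : Submodule F V) {z : V} (hz : z ∉ U) : ∃ k, ∀ u ∈ U, z - u ∉ Λ.lat k := by
  haveI : Nontrivial V := IsSimpleModule.nontrivial A V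
  obtain ⟨w, hw⟩ := exists_isNormalizedOrd_end F A V
  obtain ⟨e, he, hsh⟩ := Λ.exists_forall_apply_mem_iff hw
  obtain ⟨π, hπ⟩ := IsDiscreteValuationRing.exists_irreducible 𝒪[F]
  have hπ0 : (π : F) ≠ 0 := fun h => hπ.ne_zero (Subtype.ext h)
  have hπ1 : algebraMap F (Module.End A V) π ≠ 0 := by simpa using hπ0
  have hpos := map_uniformizer_pos hw hπ
  set c := e * w (algebraMap F (Module.End A V) π) with hc
  have hc0 : 0 < c := mul_pos (by omega) hpos
  have hmul : ∀ k v, (π : F) • v ∈ Λ.lat (k + c) ↔ v ∈ Λ.lat k := fun k v => hsh _ hπ1 k v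
  have hpow : ∀ (N : ℕ) v, v ∈ Λ.lat (N * c) → ∃ v' ∈ Λ.lat 0, v = π ^ N • v' := by
    intro N
    induction N with
    | zero => intro v hv; exact ⟨v, by simpa using hv, by simp⟩
    | succ N ih =>
      intro v hv
      have h1 : v = (π : F) • ((π : F)⁻¹ • v) := (smul_inv_smul₀ hπ0 v).symm
      rw [h1] at hv
      push_cast at hv
      rw [add_mul, one_mul, hmul] at hv
      obtain ⟨v', hv', h2⟩ := ih _ hv
      refine ⟨v', hv', ?_⟩
      rw [h1, h2, pow_succ', mul_smul]
      rfl
  by_contra! hcon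
  let q : V →ₗ[𝒪[F]] V ⧸ U := U.mkQ.restrictScalars 𝒪[F]
  let M : Submodule 𝒪[F] (V ⧸ U) := (Λ.lat 0).map q
  haveI : Module.Finite 𝒪[F] M := Module.Finite.iff_fg.2 ((Λ.isLattice 0).fg.map q)
  have hex : ∀ N : ℕ, ∃ m ∈ M, q z = π ^ N • m := by
    intro N
    obtain ⟨u, hu, hk⟩ := hcon (N * c)
    obtain ⟨v', hv', h1⟩ := hpow N _ hk
    refine ⟨q v', ⟨v', hv', rfl⟩, ?_⟩
    rw [← map_smul, ← h1]
    change U.mkQ z = U.mkQ (z - u)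
    rw [map_sub, sub_eq_self.2]
    simpa using hu
  have hzM : q z ∈ M := by
    obtain ⟨m, hm, h⟩ := hex 0
    rw [h, pow_zero, one_smul]; exact hm
  have hbot := Ideal.iInf_pow_smul_eq_bot_of_isLocalRing (M := M) (Ideal.span {π})
    (by rw [Ne, Ideal.span_singleton_eq_top]; exact hπ.not_isUnit)
  have hmem : (⟨q z, hzM⟩ : M) ∈ (⨅ i : ℕ, Ideal.span {π} ^ i • ⊤ : Submodule 𝒪[F] M) := by
    rw [Submodule.mem_iInf]
    intro N
    obtain ⟨m, hm, h⟩ := hex N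
    have : (⟨q z, hzM⟩ : M) = π ^ N • ⟨m, hm⟩ := Subtype.ext h
    rw [this]
    exact Submodule.smul_mem_smul (Ideal.pow_mem_pow (Ideal.mem_span_singleton_self π) N) trivial
  rw [hbot, Submodule.mem_bot] at hmem
  have h0 : U.mkQ z = 0 := congrArg Subtype.val hmem
  rw [Submodule.mkQ_apply, Submodule.Quotient.mk_eq_zero] at h0
  exact hz h0

theorem exists_mem_lat (Λ : LatticeSeq F A V) [FiniteDimensional F V] (v : V) :
    ∃ k, v ∈ Λ.lat k := by
  haveI : Nontrivial V := IsSimpleModule.nontrivial A V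
  obtain ⟨w, hw⟩ := exists_isNormalizedOrd_end F A V
  obtain ⟨e, he, hsh⟩ := Λ.exists_forall_apply_mem_iff hw
  have hv : v ∈ Submodule.span F (Λ.lat 0 : Set V) := by
    rw [(Λ.isLattice 0).span_eq_top]; trivial
  obtain ⟨s, hs⟩ := multiple_mem_span_of_mem_localization_span (nonZeroDivisors 𝒪[F]) F _ v hv
  rw [Submodule.span_eq] at hs
  have hs0 : ((s : 𝒪[F]) : F) ≠ 0 := fun h => nonZeroDivisors.ne_zero s.2 (Subtype.ext h)
  have hs1 : algebraMap F (Module.End A V) (s : 𝒪[F]) ≠ 0 := by simp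
  refine ⟨-(e * w (algebraMap F (Module.End A V) (s : 𝒪[F]))), ?_⟩
  rw [← hsh _ hs1, neg_add_cancel]
  exact hs

/-- The largest `k` such that `v ∈ Λ_k`, for `v ≠ 0`. -/
noncomputable def ord (Λ : LatticeSeq F A V) (v : V) : ℤ :=
  sSup {k | v ∈ Λ.lat k}

variable [FiniteDimensional F V]

theorem mem_lat_iff (Λ : LatticeSeq F A V) {v : V} (hv : v ≠ 0) {k : ℤ} :
    v ∈ Λ.lat k ↔ k ≤ Λ.ord v := by
  obtain ⟨k₁, hk₁⟩ := Λ.exists_mem_lat v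
  obtain ⟨k₂, hk₂⟩ := Λ.exists_forall_sub_notMem ⊥ (z := v) (by simpa using hv)
  have hk₂' : v ∉ Λ.lat k₂ := by simpa using hk₂ 0 (Submodule.zero_mem _)
  have hb : BddAbove {k | v ∈ Λ.lat k} := by
    refine ⟨k₂, fun k hk => ?_⟩
    by_contra! hlt
    exact hk₂' (Λ.antitone hlt.le hk)
  refine ⟨fun h => le_csSup hb h, fun h => Λ.antitone h (Int.csSup_mem ⟨k₁, hk₁⟩ hb)⟩

theorem mem_lat_ord (Λ : LatticeSeq F A V) (v : V) : v ∈ Λ.lat (Λ.ord v) := by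
  by_cases hv : v = 0
  · simp [hv]
  · exact (Λ.mem_lat_iff hv).2 le_rfl

theorem min_ord_le_ord_add (Λ : LatticeSeq F A V) {u v : V} (h : u + v ≠ 0) :
    min (Λ.ord u) (Λ.ord v) ≤ Λ.ord (u + v) := by
  rw [← Λ.mem_lat_iff h]
  exact add_mem (Λ.antitone (min_le_left _ _) (Λ.mem_lat_ord u))
    (Λ.antitone (min_le_right _ _) (Λ.mem_lat_ord v))

theorem ord_eq_of_forall_mem_iff (Λ : LatticeSeq F A V) {u v : V} (hu : u ≠ 0) (hv : v ≠ 0) {n : ℤ}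
    (h : ∀ k, u ∈ Λ.lat (k + n) ↔ v ∈ Λ.lat k) : Λ.ord u = Λ.ord v + n := by
  have h1 := (h (Λ.ord v)).2 (Λ.mem_lat_ord v)
  have h2 := (h (Λ.ord u - n)).1 (by rw [sub_add_cancel]; exact Λ.mem_lat_ord u)
  rw [Λ.mem_lat_iff hu] at h1
  rw [Λ.mem_lat_iff hv] at h2
  omega

theorem exists_forall_ord_sub_le (Λ : LatticeSeq F A V) (U : Submodule F V) {z : V} (hz : z ∉ U) :
    ∃ C, ∀ u ∈ U, Λ.ord (z - u) ≤ C := by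
  obtain ⟨k, hk⟩ := Λ.exists_forall_sub_notMem U hz
  refine ⟨k, fun u hu => ?_⟩
  by_contra! hlt
  exact hk u hu (Λ.antitone hlt.le (Λ.mem_lat_ord _))

end LatticeSeq

end Ord

/-! ### The double commutant of `A` on `V` -/

section Density

variable {F : Type*} [Field F] {A : Type*} [Ring A] [Algebra F A]
  {V : Type*} [AddCommGroup V] [Module F V] [Module A V] [IsScalarTower F A V]

theorem finiteDimensional_of_isSimpleModule (F A V : Type*) [Field F] [Ring A] [Algebra F A]
    [AddCommGroup V] [Module F V] [Module A V] [IsScalarTower F A V]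
    [FiniteDimensional F A] [IsSimpleModule A V] : FiniteDimensional F V :=
  Module.Finite.trans A V

/-- Jacobson density, `V` being finite over `Module.End A V`. -/
theorem exists_forall_smul_eq_of_commute [IsSimpleModule A V] [FiniteDimensional F V]
    (ψ : Module.End F V) (h : ∀ (δ : Module.End A V) (v : V), ψ (δ v) = δ (ψ v)) :
    ∃ a : A, ∀ v, a • v = ψ v := by
  haveI : Module.Finite (Module.End A V) V :=
    Module.Finite.of_restrictScalars_finite F (Module.End A V) V
  let f : Module.End (Module.End A V) V :=
    { toFun := ψ, map_add' := ψ.map_add, map_smul' := fun δ v => h δ v }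
  obtain ⟨a, ha⟩ := Module.Finite.toModuleEnd_moduleEnd_surjective (R := A) (M := V) f
  exact ⟨a, fun v => DFunLike.congr_fun ha v⟩

theorem eq_of_forall_smul_eq [IsSimpleRing A] [Nontrivial V] {a b : A}
    (h : ∀ v : V, a • v = b • v) : a = b := by
  haveI : Nontrivial (AddMonoid.End V) := by
    obtain ⟨v, hv⟩ := exists_ne (0 : V)
    exact ⟨0, 1, fun h => hv (DFunLike.congr_fun h v).symm⟩
  exact RingHom.injective (Module.toAddMonoidEnd A V) (AddMonoidHom.ext h)

theorem exists_eq_algebraMap_of_forall_commute [IsSimpleRing A] [Algebra.IsCentral F A]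
    [IsSimpleModule A V] [FiniteDimensional F V] (x : Module.End A V) (hx : ∀ y, x * y = y * x) :
    ∃ a : F, x = algebraMap F (Module.End A V) a := by
  haveI : Nontrivial V := IsSimpleModule.nontrivial A V
  obtain ⟨a, ha⟩ := exists_forall_smul_eq_of_commute (A := A) (Module.End.toEndBase F x)
    fun δ v => DFunLike.congr_fun (hx δ) v
  have ha' : ∀ v, a • v = x v := ha
  have hc : a ∈ Subalgebra.center F A := by
    rw [Subalgebra.mem_center_iff]
    intro b
    refine eq_of_forall_smul_eq (V := V) fun v => ?_
    rw [mul_smul, mul_smul, ha', ha', map_smul]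
  obtain ⟨c, hc⟩ := Algebra.IsCentral.out hc
  refine ⟨c, LinearMap.ext fun v => ?_⟩
  rw [← ha', ← show algebraMap F A c = a from hc, algebraMap_smul]
  rfl

/-- Every `F`-linear endomorphism `φ` of `V` is a sum of products of elements `d t` of
`D = Module.End A V` and elements `b t` of `A`, where `b t` is a combination of products
`u * φ * v` with `u` and `v` in `D` such that `u * v` has the valuation of `(d t)⁻¹`. -/
def DecomposesEnd (F : Type*) [Field F] {A : Type*} [Ring A] [Algebra F A]
    {V : Type*} [AddCommGroup V] [Module F V] [Module A V] [IsScalarTower F A V]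
    (w : Module.End A V → ℤ) : Prop :=
  ∀ φ : Module.End F V, ∃ (T : Finset (ℕ × ℕ)) (d : ℕ × ℕ → Module.End A V) (b : ℕ × ℕ → A),
    (∀ v, φ v = ∑ t ∈ T, d t (b t • v)) ∧ ∀ t, d t ≠ 0 ∧
      Algebra.lsmul F F V (b t) ∈ AddSubgroup.closure {ψ | ∃ x y : Module.End A V, x ≠ 0 ∧ y ≠ 0 ∧
        w x + w y = -w (d t) ∧ ψ = Module.End.toEndBase F x * φ * Module.End.toEndBase F y}

end Density

/-! ### Elements of `A` and `B` with prescribed effect on orders -/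

section Local

variable {F : Type*} [Field F] [ValuativeRel F] [TopologicalSpace F] [IsNonarchimedeanLocalField F]
  {A : Type*} [Ring A] [Algebra F A]
  {V : Type*} [AddCommGroup V] [Module F V] [Module A V] [IsScalarTower F A V]
  [IsSimpleModule A V] [FiniteDimensional F V]

variable (F A V) in
theorem exists_isNormalizedOrd_decomposesEnd [IsSimpleRing A] [Algebra.IsCentral F A] :
    ∃ w : Module.End A V → ℤ, IsNormalizedOrd 𝒪[F] w ∧ DecomposesEnd F w := by
  classical
  haveI : FiniteDimensional F (Module.End A V) := Module.End.finiteDimensional_of_isScalarTower F A V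
  obtain ⟨w, hw, ζ, ϖ, N, r, h⟩ := exists_isNormalizedOrd F (Module.End A V)
  refine ⟨w, hw, fun φ => ?_⟩
  obtain ⟨T, d, b, h1, h2⟩ := h.exists_decomposition hw exists_eq_algebraMap_of_forall_commute
    (Module.End.toEndBase F) φ
  choose h3 h4 h5 using h2
  have hb : ∀ t, ∃ a : A, ∀ v, a • v = b t v := fun t =>
    exists_forall_smul_eq_of_commute (b t) fun δ v => (DFunLike.congr_fun (h4 t δ) v).symm
  choose a ha using hb
  have ha' : ∀ t, Algebra.lsmul F F V (a t) = b t := fun t => LinearMap.ext (ha t)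
  refine ⟨T, d, a, fun v => ?_, fun t => ⟨h3 t, by rw [ha']; exact h5 t⟩⟩
  rw [h1, LinearMap.sum_apply]
  exact Finset.sum_congr rfl fun t _ => by rw [ha]; rfl

/-- Each `b t` is a combination of products `x * φ * y` with `x`, `y` in `D`. These commute with `E`
when `φ` does, and `A` acts faithfully on `V`. -/
theorem DecomposesEnd.exists_commutant [IsSimpleRing A] {w : Module.End A V → ℤ} (h : DecomposesEnd F w)
    {E : Type*} [Field E] [Algebra F E] (ι : E →ₐ[F] A) (φ : Module.End F V)
    (hφ : ∀ x v, φ (ι x • v) = ι x • φ v) :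
    ∃ (T : Finset (ℕ × ℕ)) (d : ℕ × ℕ → Module.End A V) (b : ℕ × ℕ → commutant ι),
      (∀ v, φ v = ∑ t ∈ T, d t ((b t : A) • v)) ∧ ∀ t, d t ≠ 0 ∧
        Algebra.lsmul F F V (b t : A) ∈ AddSubgroup.closure {ψ | ∃ x y : Module.End A V,
          x ≠ 0 ∧ y ≠ 0 ∧ w x + w y = -w (d t) ∧
          ψ = Module.End.toEndBase F x * φ * Module.End.toEndBase F y} := by
  haveI : Nontrivial V := IsSimpleModule.nontrivial A V
  obtain ⟨T, d, b, h1, h2⟩ := h φ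
  have key : ∀ t, b t ∈ commutant ι := by
    intro t
    have h3 : ∀ ψ ∈ AddSubgroup.closure {ψ | ∃ x y : Module.End A V, x ≠ 0 ∧ y ≠ 0 ∧
        w x + w y = -w (d t) ∧ ψ = Module.End.toEndBase F x * φ * Module.End.toEndBase F y},
        ∀ x v, ψ (ι x • v) = ι x • ψ v := by
      intro ψ hψ z v
      induction hψ using AddSubgroup.closure_induction with
      | mem ψ hψ =>
        obtain ⟨x, y, -, -, -, rfl⟩ := hψ
        change x (φ (y (ι z • v))) = ι z • x (φ (y v))
        rw [map_smul, hφ, map_smul]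
      | zero => simp
      | add a b _ _ ha hb => rw [LinearMap.add_apply, LinearMap.add_apply, ha, hb, smul_add]
      | neg a _ ha => rw [LinearMap.neg_apply, LinearMap.neg_apply, ha, smul_neg]
    rw [Subalgebra.mem_centralizer_iff]
    rintro _ ⟨z, rfl⟩
    refine eq_of_forall_smul_eq (V := V) fun v => ?_
    rw [mul_smul, mul_smul]
    exact (h3 _ (h2 t).2 z v).symm
  exact ⟨T, d, fun t => ⟨b t, key t⟩, h1, h2⟩

namespace LatticeSeq

theorem mem_normalizer_iff {F A V : Type*} [Field F] [ValuativeRel F] [Ring A] [Algebra F A]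
    [AddCommGroup V] [Module F V] [Module A V] [IsScalarTower F A V] {Λ : LatticeSeq F A V} {g : Aˣ} :
    g ∈ Λ.normalizer ↔ ∃ n : ℤ, ∀ k v, (g : A) • v ∈ Λ.lat (k + n) ↔ v ∈ Λ.lat k := by
  refine exists_congr fun n => forall_congr' fun k => ?_
  rw [Set.ext_iff]
  constructor
  · intro h v
    have h1 := h ((g : A) • v)
    simp only [Set.mem_image, SetLike.mem_coe] at h1
    rw [← h1]
    refine ⟨?_, fun h => ⟨v, h, rfl⟩⟩
    rintro ⟨u, hu, he⟩
    have : u = v := by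
      have := congrArg (fun z => (↑g⁻¹ : A) • z) he
      simpa [smul_smul] using this
    rwa [← this]
  · intro h v
    have h1 := h ((↑g⁻¹ : A) • v)
    rw [smul_smul, Units.mul_inv, one_smul] at h1
    rw [SetLike.mem_coe, h1]
    constructor
    · rintro ⟨u, hu, rfl⟩
      simpa [smul_smul] using hu
    · intro h2
      exact ⟨_, h2, by simp [smul_smul]⟩

theorem mem_filtration_iff (Λ : LatticeSeq F A V) {a : A} {k : ℤ} :
    a ∈ Λ.filtration k ↔ ∀ v, v ≠ 0 → a • v ≠ 0 → Λ.ord v + k ≤ Λ.ord (a • v) := by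
  constructor
  · intro h v _ h2
    rw [← Λ.mem_lat_iff h2]
    exact h _ v (Λ.mem_lat_ord v)
  · intro h l v hv
    by_cases h0 : v = 0
    · simp [h0]
    by_cases h1 : a • v = 0
    · simp [h1]
    rw [Λ.mem_lat_iff h1]
    rw [Λ.mem_lat_iff h0] at hv
    have := h v h0 h1
    omega

theorem ord_apply (Λ : LatticeSeq F A V) {w : Module.End A V → ℤ} {e : ℤ}
    (hsh : ∀ δ : Module.End A V, δ ≠ 0 → ∀ k v, δ v ∈ Λ.lat (k + e * w δ) ↔ v ∈ Λ.lat k)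
    {δ : Module.End A V} (hδ : δ ≠ 0) {v : V} (hv : v ≠ 0) : Λ.ord (δ v) = Λ.ord v + e * w δ := by
  refine Λ.ord_eq_of_forall_mem_iff ?_ hv (fun k => hsh δ hδ k v)
  intro h0
  obtain ⟨ε, -, h2⟩ := Module.End.exists_mul_eq_one hδ
  apply hv
  rw [← Module.End.one_apply (R := A) v, ← h2, Module.End.mul_apply, h0, map_zero]

/-- Orthogonality over `D` gives a `D`-linear map, which comes from `A` by density. -/
theorem exists_smul_eq_mem_filtration (Λ : LatticeSeq F A V) {x y : V} (hx : x ≠ 0) :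
    ∃ a : A, a • x = y ∧ a ∈ Λ.filtration (Λ.ord y - Λ.ord x) := by
  classical
  haveI : Nontrivial V := IsSimpleModule.nontrivial A V
  obtain ⟨w, hw⟩ := exists_isNormalizedOrd_end F A V
  obtain ⟨e, he, hsh⟩ := Λ.exists_forall_apply_mem_iff hw
  haveI : FiniteDimensional (Module.End A V) V :=
    Module.Finite.of_restrictScalars_finite F (Module.End A V) V
  obtain ⟨φ, h1, h2⟩ := exists_linearMap_map_eq_of_ord (Δ := Module.End A V) Λ.ord
    (fun δ => e * w δ) (fun δ v hδ hv => Λ.ord_apply hsh hδ hv)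
    (fun u v _ _ h => Λ.min_ord_le_ord_add h)
    (fun U z hz => Λ.exists_forall_ord_sub_le (U.restrictScalars F) hz) hx y
  obtain ⟨a, ha⟩ := exists_forall_smul_eq_of_commute (A := A) (φ.restrictScalars F)
    fun δ v => φ.map_smul δ v
  have ha' : ∀ v, a • v = φ v := ha
  refine ⟨a, by rw [ha', h1], ?_⟩
  rw [mem_filtration_iff]
  intro v hv h0
  rw [ha'] at h0 ⊢
  have := h2 v h0
  omega

/-- Purity makes `ord` an order function over `E`, so some `E`-linear `φ` sends `x` to `y` and
raises orders by at least `ord y - ord x`. In its decomposition `b t` combines products `u * φ * v`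
with `w u + w v = -w (d t)`, hence the correction by `e * w (d t)`. -/
theorem exists_sum_commutant [IsSimpleRing A] (Λ : LatticeSeq F A V) {w : Module.End A V → ℤ}
    (hdec : DecomposesEnd F w) {e : ℤ}
    (hsh : ∀ δ : Module.End A V, δ ≠ 0 → ∀ k v, δ v ∈ Λ.lat (k + e * w δ) ↔ v ∈ Λ.lat k)
    {E : Type*} [Field E] [Algebra F E] {ι : E →ₐ[F] A} (hΛ : Λ.IsPure ι)
    {x y : V} (hx : x ≠ 0) :
    ∃ (T : Finset (ℕ × ℕ)) (d : ℕ × ℕ → Module.End A V) (b : ℕ × ℕ → commutant ι),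
      y = ∑ t ∈ T, d t ((b t : A) • x) ∧ ∀ t, d t ≠ 0 ∧
        (b t : A) ∈ Λ.filtration (Λ.ord y - Λ.ord x - e * w (d t)) := by
  letI : Module E V := Module.compHom V (ι : E →+* A)
  haveI : IsScalarTower F E V := ⟨fun c z v => by
    change ι (c • z) • v = c • (ι z • v)
    rw [map_smul, smul_assoc]⟩
  haveI : FiniteDimensional E V := Module.Finite.of_restrictScalars_finite F E V
  have hn : ∀ z : E, ∃ n : ℤ, z ≠ 0 → ∀ v, v ≠ 0 → Λ.ord (ι z • v) = Λ.ord v + n := by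
    intro z
    by_cases hz : z = 0
    · exact ⟨0, fun h => absurd hz h⟩
    obtain ⟨n, hn⟩ := mem_normalizer_iff.1 (hΛ (Units.mk0 z hz))
    refine ⟨n, fun _ v hv => Λ.ord_eq_of_forall_mem_iff ?_ hv fun k => hn k v⟩
    exact (smul_ne_zero hz hv : z • v ≠ 0)
  choose n hn using hn
  obtain ⟨φ, h1, h2⟩ := exists_linearMap_map_eq_of_ord (Δ := E) Λ.ord n
    (fun z v hz hv => hn z hz v hv) (fun u v _ _ h => Λ.min_ord_le_ord_add h)
    (fun U z hz => Λ.exists_forall_ord_sub_le (U.restrictScalars F) hz) hx y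
  obtain ⟨T, d, b, h3, h4⟩ := hdec.exists_commutant ι (φ.restrictScalars F)
    fun z v => φ.map_smul z v
  refine ⟨T, d, b, by rw [← h3 x]; exact h1.symm, fun t => ⟨(h4 t).1, ?_⟩⟩
  set s := Λ.ord y - Λ.ord x with hs
  have hφ : ∀ l v, v ∈ Λ.lat l → φ v ∈ Λ.lat (l + s) := by
    intro l v hv
    by_cases h0 : φ v = 0
    · simp [h0]
    have hv0 : v ≠ 0 := by rintro rfl; simp at h0
    rw [Λ.mem_lat_iff h0]
    rw [Λ.mem_lat_iff hv0] at hv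
    have := h2 v h0
    omega
  intro l v hv
  have key : ∀ ψ ∈ AddSubgroup.closure {ψ | ∃ x y : Module.End A V, x ≠ 0 ∧ y ≠ 0 ∧
      w x + w y = -w (d t) ∧
      ψ = Module.End.toEndBase F x * φ.restrictScalars F * Module.End.toEndBase F y},
      ψ v ∈ Λ.lat (l + (s - e * w (d t))) := by
    intro ψ hψ
    induction hψ using AddSubgroup.closure_induction with
    | mem ψ hψ =>
      obtain ⟨x', y', hx', hy', hxy, rfl⟩ := hψ
      change x' (φ (y' v)) ∈ _
      have h5 := (hsh x' hx' _ _).2 (hφ _ _ ((hsh y' hy' l v).2 hv))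
      convert h5 using 2
      rw [sub_eq_add_neg, ← mul_neg, ← hxy]; ring
    | zero => simp
    | add a b _ _ ha hb => exact add_mem ha hb
    | neg a _ ha => exact neg_mem ha
  exact key _ (h4 t).2

end LatticeSeq

end Local

theorem ceil_intCast_div_le_iff {ρ : ℕ} (h : 1 ≤ ρ) {k l : ℤ} :
    ⌈(k : ℝ) / (ρ : ℝ)⌉ ≤ l ↔ k ≤ ρ * l := by
  rw [Int.ceil_le, div_le_iff₀ (by positivity), mul_comm]
  exact_mod_cast Iff.rfl

/-! ### `V_E` as a direct summand of `V` over `B` -/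

section Socle

variable {F : Type*} [Field F] [ValuativeRel F] [TopologicalSpace F] [IsNonarchimedeanLocalField F]
  {A : Type*} [Ring A] [Algebra F A] [IsSimpleRing A]
  {V : Type*} [AddCommGroup V] [Module F V] [Module A V] [IsScalarTower F A V]
  [IsSimpleModule A V] [FiniteDimensional F V] {w : Module.End A V → ℤ}
  {E : Type*} [Field E] [Algebra F E] (ι : E →ₐ[F] A)

/-- An `E`-linear map sending `x` to `y` is a sum of products of elements of `D` and of `B`. -/
theorem DecomposesEnd.mem_of_forall_mem (hdec : DecomposesEnd F w) (S : AddSubgroup V)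
    (hD : ∀ (δ : Module.End A V), ∀ v ∈ S, δ v ∈ S)
    (hB : ∀ (b : commutant ι), ∀ v ∈ S, (b : A) • v ∈ S) {x : V} (hx : x ≠ 0) (hxS : x ∈ S)
    (y : V) : y ∈ S := by
  letI : Module E V := Module.compHom V (ι : E →+* A)
  haveI : IsScalarTower F E V := ⟨fun c z v => by
    change ι (c • z) • v = c • (ι z • v)
    rw [map_smul, smul_assoc]⟩
  obtain ⟨f, hf, -⟩ := Submodule.exists_le_ker_of_notMem (p := (⊥ : Submodule E V)) (v := x)
    (by simpa using hx)
  let φ : V →ₗ[E] V := (LinearMap.toSpanSingleton E V ((f x)⁻¹ • y)).comp f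
  obtain ⟨T, d, b, h3, -⟩ := hdec.exists_commutant ι (φ.restrictScalars F) fun z v => φ.map_smul z v
  have h4 : (φ.restrictScalars F) x = y := by simp [φ, smul_smul, hf]
  rw [← h4, h3]
  exact S.sum_mem fun t _ => hD _ _ (hB _ _ hxS)

/-- The `B`-socle is nonzero, and it is stable under `D`, whose nonzero elements are
`B`-automorphisms of `V` and so permute simple submodules. Thus it is all of `V`. -/
theorem DecomposesEnd.isSemisimpleModule_commutant (hdec : DecomposesEnd F w) :
    IsSemisimpleModule (commutant ι) V := by
  haveI : Nontrivial V := IsSimpleModule.nontrivial A V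
  haveI : IsArtinian (commutant ι) V := isArtinian_of_tower F inferInstance
  apply IsSemisimpleModule.of_sSup_simples_eq_top
  set M : Submodule (commutant ι) V := sSup {m | IsSimpleModule (commutant ι) m} with hM
  obtain ⟨S, hS⟩ := IsAtomic.exists_atom (Submodule (commutant ι) V)
  rw [← isSimpleModule_iff_isAtom] at hS
  haveI := hS
  haveI : Nontrivial S := IsSimpleModule.nontrivial (commutant ι) S
  obtain ⟨s, hs⟩ := exists_ne (0 : S)
  have hSM : S ≤ M := le_sSup hS
  rw [eq_top_iff]
  rintro y -
  refine hdec.mem_of_forall_mem ι M.toAddSubgroup ?_ (fun b v hv => M.smul_mem b hv)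
    (x := (s : V)) (by simpa using hs) (hSM s.2) y
  intro δ v hv
  by_cases hδ : δ = 0
  · simp [hδ]
  let f : V →ₗ[commutant ι] V :=
    { toFun := δ, map_add' := δ.map_add, map_smul' := fun b v => δ.map_smul (b : A) v }
  have hf : Function.Injective f := by
    obtain ⟨ε, -, h2⟩ := Module.End.exists_mul_eq_one hδ
    exact Function.LeftInverse.injective (g := ε) fun v => DFunLike.congr_fun h2 v
  have hle : M ≤ M.comap f := by
    refine sSup_le fun m hm => ?_
    haveI : IsSimpleModule (commutant ι) m := hm
    rw [← Submodule.map_le_iff_le_comap]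
    exact le_sSup (IsSimpleModule.congr (Submodule.equivMapOfInjective f hf m).symm)
  exact hle hv

/-- Faithfulness embeds `B` in a power of `V`, so `B` is semisimple and its quotient `VE` lifts to a
left ideal. A generator of that ideal acts nontrivially on some `v`, giving an embedding into `V`,
which splits. -/
theorem DecomposesEnd.exists_commutant_linearMap (hdec : DecomposesEnd F w) (VE : Type*)
    [AddCommGroup VE] [Module (commutant ι) VE] [IsSimpleModule (commutant ι) VE] :
    ∃ (j : VE →ₗ[commutant ι] V) (ψ : V →ₗ[commutant ι] VE), ∀ v, ψ (j v) = v := by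
  haveI : Nontrivial V := IsSimpleModule.nontrivial A V
  haveI := hdec.isSemisimpleModule_commutant ι
  have hfaith : ∀ b : commutant ι, b ≠ 0 → ∃ v : V, b • v ≠ 0 := by
    intro b hb
    by_contra! h
    exact hb (Subtype.ext (eq_of_forall_smul_eq (V := V) fun v => by
      rw [ZeroMemClass.coe_zero, zero_smul]; exact h v))
  let bas := Module.finBasis F V
  let f : commutant ι →ₗ[commutant ι] (Fin (Module.finrank F V) → V) :=
    LinearMap.pi fun i => LinearMap.toSpanSingleton (commutant ι) V (bas i)
  have hf : Function.Injective f := by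
    rw [← LinearMap.ker_eq_bot, LinearMap.ker_eq_bot']
    intro b hb
    by_contra h0
    obtain ⟨v, hv⟩ := hfaith b h0
    apply hv
    have h1 : Algebra.lsmul F F V b = 0 := bas.ext fun i => congrFun hb i
    exact DFunLike.congr_fun h1 v
  haveI : IsSemisimpleModule (commutant ι) (commutant ι) := IsSemisimpleModule.of_injective f hf
  haveI : Nontrivial VE := IsSimpleModule.nontrivial (commutant ι) VE
  obtain ⟨v0, hv0⟩ := exists_ne (0 : VE)
  obtain ⟨s, hs⟩ := IsSemisimpleModule.lifting_property
    (LinearMap.toSpanSingleton (commutant ι) VE v0)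
    (IsSimpleModule.toSpanSingleton_surjective _ hv0) LinearMap.id
  have hs0 : s v0 ≠ 0 := by
    intro h0
    have := DFunLike.congr_fun hs v0
    rw [LinearMap.comp_apply, h0, map_zero] at this
    exact hv0 this.symm
  obtain ⟨v, hv⟩ := hfaith _ hs0
  let j : VE →ₗ[commutant ι] V := (LinearMap.toSpanSingleton (commutant ι) V v).comp s
  have hj : Function.Injective j := (LinearMap.injective_or_eq_zero j).resolve_right fun h =>
    hv (DFunLike.congr_fun h v0)
  obtain ⟨ψ, hψ⟩ := IsSemisimpleModule.extension_property j hj LinearMap.id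
  exact ⟨j, ψ, fun v => DFunLike.congr_fun hψ v⟩

end Socle

/-! ### Filtrations and normalizers in terms of orders -/

namespace LatticeSeq

variable {F : Type*} [Field F] [ValuativeRel F] [TopologicalSpace F] [IsNonarchimedeanLocalField F]
  {A : Type*} [Ring A] [Algebra F A]
  {V : Type*} [AddCommGroup V] [Module F V] [Module A V] [IsScalarTower F A V]
  [IsSimpleModule A V] [FiniteDimensional F V] {w : Module.End A V → ℤ}

theorem filtration_anti (Λ : LatticeSeq F A V) : Antitone Λ.filtration :=
  fun _ _ h _ ha l v hv => Λ.antitone (by omega) (ha l v hv)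

theorem mem_filtration_iff_le (Λ : LatticeSeq F A V) {a : A} {n : ℤ}
    (h : ∀ k v, a • v ∈ Λ.lat (k + n) ↔ v ∈ Λ.lat k) (ha : ∀ v : V, a • v = 0 → v = 0) {k : ℤ} :
    a ∈ Λ.filtration k ↔ k ≤ n := by
  haveI : Nontrivial V := IsSimpleModule.nontrivial A V
  obtain ⟨v, hv⟩ := exists_ne (0 : V)
  rw [mem_filtration_iff]
  have hord : ∀ v, v ≠ 0 → Λ.ord (a • v) = Λ.ord v + n := fun v hv =>
    Λ.ord_eq_of_forall_mem_iff (fun h0 => hv (ha v h0)) hv fun k => h k v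
  constructor
  · intro h1
    have := h1 v hv (fun h0 => hv (ha v h0))
    rw [hord v hv] at this
    omega
  · intro h1 v hv _
    rw [hord v hv]
    omega

theorem exists_ord_le_of_eq_sum (Λ : LatticeSeq F A V) {T : Finset (ℕ × ℕ)} {f : ℕ × ℕ → V} {y : V}
    (hy : y ≠ 0) (h : y = ∑ t ∈ T, f t) : ∃ t ∈ T, f t ≠ 0 ∧ Λ.ord (f t) ≤ Λ.ord y := by
  by_contra! hcon
  have h1 : ∑ t ∈ T, f t ∈ Λ.lat (Λ.ord y + 1) := by
    refine (Λ.lat (Λ.ord y + 1)).sum_mem fun t ht => ?_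
    by_cases h0 : f t = 0
    · rw [h0]; exact (Λ.lat _).zero_mem
    · rw [Λ.mem_lat_iff h0]
      exact hcon t ht h0
  rw [← h, Λ.mem_lat_iff hy] at h1
  omega

theorem IsStrict.exists_ord_eq {Λ : LatticeSeq F A V} (h : Λ.IsStrict) (k : ℤ) :
    ∃ v, v ≠ 0 ∧ Λ.ord v = k := by
  obtain ⟨v, hv, hv'⟩ := SetLike.exists_of_lt (h (lt_add_one k))
  have hv0 : v ≠ 0 := by rintro rfl; exact hv' (Submodule.zero_mem _)
  rw [Λ.mem_lat_iff hv0] at hv hv'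
  exact ⟨v, hv0, by omega⟩

theorem mem_normalizer_of_forall_le {Λ : LatticeSeq F A V} {g : Aˣ}
    (h : ∀ x y : V, x ≠ 0 → y ≠ 0 →
      Λ.ord ((g : A) • x) + Λ.ord y ≤ Λ.ord ((g : A) • y) + Λ.ord x) :
    g ∈ Λ.normalizer := by
  haveI : Nontrivial V := IsSimpleModule.nontrivial A V
  obtain ⟨z, hz⟩ := exists_ne (0 : V)
  rw [mem_normalizer_iff]
  refine ⟨Λ.ord ((g : A) • z) - Λ.ord z, fun k v => ?_⟩
  by_cases hv : v = 0
  · simp [hv]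
  have hgv : (g : A) • v ≠ 0 := fun h0 => hv (by
    have := congrArg (fun x => (↑g⁻¹ : A) • x) h0
    simpa [smul_smul] using this)
  rw [Λ.mem_lat_iff hgv, Λ.mem_lat_iff hv]
  have h1 := h z v hz hv
  have h2 := h v z hv hz
  omega

theorem smul_mem_lat_iff (Λ : LatticeSeq F A V) {e : ℤ}
    (hsh : ∀ δ : Module.End A V, δ ≠ 0 → ∀ k v, δ v ∈ Λ.lat (k + e * w δ) ↔ v ∈ Λ.lat k)
    {a : F} (ha : a ≠ 0) (k : ℤ) (v : V) :
    a • v ∈ Λ.lat (k + e * w (algebraMap F _ a)) ↔ v ∈ Λ.lat k := by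
  haveI : Nontrivial V := IsSimpleModule.nontrivial A V
  exact hsh (algebraMap F _ a) (by simpa using ha) k v

theorem exists_smul_mem_iff (Λ : LatticeSeq F A V) {π : 𝒪[F]} (hπ : Irreducible π) :
    ∃ m : ℤ, 0 < m ∧ ∀ k v, (π : F) • v ∈ Λ.lat (k + m) ↔ v ∈ Λ.lat k := by
  obtain ⟨w, hw⟩ := exists_isNormalizedOrd_end F A V
  obtain ⟨e, he, hsh⟩ := Λ.exists_forall_apply_mem_iff hw
  exact ⟨e * w (algebraMap F _ π), mul_pos (by omega) (map_uniformizer_pos hw hπ),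
    Λ.smul_mem_lat_iff hsh fun h => hπ.ne_zero (Subtype.ext h)⟩

end LatticeSeq

/-! ### Uniqueness of the lift and comparison of normalizers -/

namespace LatticeSeq

variable {F : Type*} [Field F] [ValuativeRel F] [TopologicalSpace F] [IsNonarchimedeanLocalField F]
  {A : Type*} [Ring A] [Algebra F A]
  {V : Type*} [AddCommGroup V] [Module F V] [Module A V] [IsScalarTower F A V]
  [IsSimpleModule A V] [FiniteDimensional F V] {w : Module.End A V → ℤ}
  {E : Type*} [Field E] [Algebra F E] {ι : E →ₐ[F] A}
  {VE : Type*} [AddCommGroup VE] [Module F VE] [Module (commutant ι) VE]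
  [IsScalarTower F (commutant ι) VE] [IsSimpleModule (commutant ι) VE] [FiniteDimensional F VE]
  {Γ : LatticeSeq F (commutant ι) VE} {Λ Λ' : LatticeSeq F A V} {ρ ρ' : ℕ}

/-- Some `b` in `B` sends `x` to `y` and lies in the filtration at level `ord y - ord x`, which
bounds the order of `j y` below. Exchanging `x` and `y` gives equality. -/
theorem ord_map_eq (j : VE →ₗ[commutant ι] V) (hj : Function.Injective j)
    (h : ∀ (k : ℤ) (b : commutant ι), b ∈ Γ.filtration k → (b : A) ∈ Λ.filtration (ρ * k)) {x y : VE}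
    (hx : x ≠ 0) (hy : y ≠ 0) :
    Λ.ord (j y) = Λ.ord (j x) + ρ * (Γ.ord y - Γ.ord x) := by
  have key : ∀ x y : VE, x ≠ 0 → y ≠ 0 →
      Λ.ord (j x) + ρ * (Γ.ord y - Γ.ord x) ≤ Λ.ord (j y) := by
    intro x y hx hy
    obtain ⟨b, rfl, hb⟩ := Γ.exists_smul_eq_mem_filtration hx (y := y)
    have hy' : j (b • x) ≠ 0 := by rwa [Ne, map_eq_zero_iff j hj]
    rw [map_smul] at hy' ⊢
    exact (Λ.mem_filtration_iff.1 (h _ b hb)) (j x) (by rwa [Ne, map_eq_zero_iff j hj]) hy'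
  have h1 := key x y hx hy
  have h2 := key y x hy hx
  have h3 : (ρ : ℤ) * (Γ.ord x - Γ.ord y) = -(ρ * (Γ.ord y - Γ.ord x)) := by ring
  omega

/-- The scalar `a` lies in `B`; its exact levels in the two filtrations are `n` and `m`. -/
theorem shift_eq_mul (hρ : 1 ≤ ρ)
    (h : ∀ (k : ℤ) (b : commutant ι),
      (b : A) ∈ Λ.filtration k ↔ b ∈ Γ.filtrationReal ((k : ℝ) / (ρ : ℝ)))
    {a : F} (ha : a ≠ 0) {m n : ℤ} (hm : ∀ k v, a • v ∈ Γ.lat (k + m) ↔ v ∈ Γ.lat k)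
    (hn : ∀ k v, a • v ∈ Λ.lat (k + n) ↔ v ∈ Λ.lat k) : n = ρ * m := by
  have h1 : ∀ k, ((algebraMap F (commutant ι) a : commutant ι) : A) ∈ Λ.filtration k ↔ k ≤ n :=
    fun k => Λ.mem_filtration_iff_le (fun k v => by
      have : ((algebraMap F (commutant ι) a : commutant ι) : A) • v = a • v := algebraMap_smul A a v
      rw [this, hn]) (fun v hv => by
      have : ((algebraMap F (commutant ι) a : commutant ι) : A) • v = a • v := algebraMap_smul A a v
      rw [this] at hv
      exact (smul_eq_zero.1 hv).resolve_left ha)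
  have h2 : ∀ k, algebraMap F (commutant ι) a ∈ Γ.filtration k ↔ k ≤ m :=
    fun k => Γ.mem_filtration_iff_le (fun k v => by rw [algebraMap_smul, hm]) (fun v hv => by
      rw [algebraMap_smul] at hv
      exact (smul_eq_zero.1 hv).resolve_left ha)
  have h3 : ∀ k, k ≤ n ↔ k ≤ ρ * m := fun k => by
    rw [← h1, h, filtrationReal, h2, ceil_intCast_div_le_iff hρ]
  exact le_antisymm ((h3 n).1 le_rfl) ((h3 _).2 le_rfl)

variable [IsSimpleRing A]

/-- Write `y` as a sum of `d t (b t • x)` adapted to `Λ`. The level of `b t` for `Λ` bounds its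
level for `Γ`, hence for `Λ'`, and some summand has `Λ'`-order at most that of `y`. The
contributions of `d t` cancel since `ρ * e' = ρ' * e`. -/
theorem mul_ord_add_le (hw : IsNormalizedOrd 𝒪[F] w) (hdec : DecomposesEnd F w)
    (hρ : 1 ≤ ρ) (hρ' : 1 ≤ ρ') (hΛ : IsStrictPureLift ι Γ ρ Λ) (hΛ' : IsStrictPureLift ι Γ ρ' Λ')
    {x y : V} (hx : x ≠ 0) (hy : y ≠ 0) :
    ρ * Λ'.ord x + ρ' * Λ.ord y ≤ ρ * Λ'.ord y + ρ' * Λ.ord x := by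
  haveI : Nontrivial V := IsSimpleModule.nontrivial A V
  obtain ⟨e, he, hsh⟩ := Λ.exists_forall_apply_mem_iff hw
  obtain ⟨e', he', hsh'⟩ := Λ'.exists_forall_apply_mem_iff hw
  obtain ⟨π, hπ⟩ := IsDiscreteValuationRing.exists_irreducible 𝒪[F]
  have hπ0 : (π : F) ≠ 0 := fun h => hπ.ne_zero (Subtype.ext h)
  obtain ⟨m, hm0, hm⟩ := Γ.exists_smul_mem_iff hπ
  have h1 := shift_eq_mul hρ hΛ.2.2 hπ0 hm (Λ.smul_mem_lat_iff hsh hπ0)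
  have h2 := shift_eq_mul hρ' hΛ'.2.2 hπ0 hm (Λ'.smul_mem_lat_iff hsh' hπ0)
  have hp := map_uniformizer_pos hw hπ
  have hee : (ρ : ℤ) * e' = ρ' * e := by
    refine mul_right_cancel₀ hp.ne' ?_
    rw [mul_assoc, h2, mul_assoc, h1]; ring
  obtain ⟨T, d, b, h3, h4⟩ := Λ.exists_sum_commutant hdec hsh hΛ.2.1 hx (y := y)
  obtain ⟨t, -, h5, h6⟩ := Λ'.exists_ord_le_of_eq_sum hy h3
  obtain ⟨hd, hb⟩ := h4 t
  have hbx : (b t : A) • x ≠ 0 := fun h => h5 (by rw [h, map_zero])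
  rw [Λ'.ord_apply hsh' hd hbx] at h6
  set k := Λ.ord y - Λ.ord x - e * w (d t) with hk
  -- The ceiling is kept on purpose: `ρ' * ⌈k / ρ⌉` is an index of `Λ'` that corresponds exactly to
  -- the level `⌈k / ρ⌉` of `Γ`.
  have hb' : (b t : A) ∈ Λ'.filtration (ρ' * ⌈(k : ℝ) / (ρ : ℝ)⌉) := by
    rw [hΛ'.2.2, filtrationReal]
    refine Γ.filtration_anti ?_ ((hΛ.2.2 k (b t)).1 hb)
    rw [ceil_intCast_div_le_iff hρ']
  have h7 := (Λ'.mem_filtration_iff.1 hb') x hx hbx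
  have h8 : k ≤ ρ * ⌈(k : ℝ) / (ρ : ℝ)⌉ := (ceil_intCast_div_le_iff hρ).1 le_rfl
  have h9 : (ρ : ℤ) * (Λ'.ord x + ρ' * ⌈(k : ℝ) / (ρ : ℝ)⌉ + e' * w (d t)) ≤ ρ * Λ'.ord y :=
    mul_le_mul_of_nonneg_left (by omega) (by positivity)
  have h10 : (ρ' : ℤ) * k ≤ ρ' * (ρ * ⌈(k : ℝ) / (ρ : ℝ)⌉) :=
    mul_le_mul_of_nonneg_left h8 (by positivity)
  have h11 : (ρ : ℤ) * (e' * w (d t)) = ρ' * e * w (d t) := by rw [← mul_assoc, hee]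
  have h12 : (ρ' : ℤ) * k = ρ' * Λ.ord y - ρ' * Λ.ord x - ρ' * e * w (d t) := by rw [hk]; ring
  have h13 : (ρ : ℤ) * (Λ'.ord x + ρ' * ⌈(k : ℝ) / (ρ : ℝ)⌉ + e' * w (d t)) =
    ρ * Λ'.ord x + ρ' * (ρ * ⌈(k : ℝ) / (ρ : ℝ)⌉) + ρ * (e' * w (d t)) := by ring
  linarith

theorem eq_and_isTranslate (hw : IsNormalizedOrd 𝒪[F] w) (hdec : DecomposesEnd F w)
    (hρ : 1 ≤ ρ) (hρ' : 1 ≤ ρ') (hΛ : IsStrictPureLift ι Γ ρ Λ) (hΛ' : IsStrictPureLift ι Γ ρ' Λ') :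
    ρ' = ρ ∧ Λ.IsTranslate Λ' := by
  haveI : Nontrivial V := IsSimpleModule.nontrivial A V
  obtain ⟨z, hz⟩ := exists_ne (0 : V)
  have h1 : ∀ x y : V, x ≠ 0 → y ≠ 0 →
      ρ * Λ'.ord x + ρ' * Λ.ord y = ρ * Λ'.ord y + ρ' * Λ.ord x := fun x y hx hy => by
    have h1 := mul_ord_add_le hw hdec hρ hρ' hΛ hΛ' hx hy
    have h2 := mul_ord_add_le hw hdec hρ hρ' hΛ hΛ' hy hx
    omega
  -- Strictness provides vectors of orders 0 and 1, and comparing them exhibits `σ'` as a multiple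
  -- of `σ`.
  have hdvd : ∀ {σ σ' : ℕ} {M M' : LatticeSeq F A V}, M.IsStrict →
      (∀ x y : V, x ≠ 0 → y ≠ 0 → σ * M'.ord x + σ' * M.ord y = σ * M'.ord y + σ' * M.ord x) →
      σ ∣ σ' := by
    intro σ σ' M M' hM h
    obtain ⟨x, hx, hx'⟩ := hM.exists_ord_eq 0
    obtain ⟨y, hy, hy'⟩ := hM.exists_ord_eq 1
    have := h x y hx hy
    rw [hx', hy', mul_one, mul_zero, add_zero] at this
    rw [← Int.natCast_dvd_natCast]
    exact ⟨M'.ord y - M'.ord x, by rw [mul_sub]; omega⟩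
  have heq : ρ' = ρ := Nat.dvd_antisymm
    (hdvd (M := Λ') (M' := Λ) hΛ'.1 fun x y hx hy => by have := h1 x y hx hy; omega)
    (hdvd (M := Λ) (M' := Λ') hΛ.1 h1)
  refine ⟨heq, Λ.ord z - Λ'.ord z, fun k => ?_⟩
  ext v
  by_cases hv : v = 0
  · simp [hv]
  rw [Λ.mem_lat_iff hv, Λ'.mem_lat_iff hv]
  have h2 := h1 v z hv hz
  rw [heq, ← mul_add, ← mul_add] at h2
  have h3 := mul_left_cancel₀ (by positivity : (ρ : ℤ) ≠ 0) h2
  omega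

/-- If `g` normalizes `Γ`, conjugation by `g` preserves each `𝔟_k`, and `exists_sum_commutant`
transfers this to orders in `V`. Conversely, a constant shift on `V` restricts to the copy of `V_E`,
where orders are multiplied by `ρ`. -/
theorem normalizer_eq_comap (hw : IsNormalizedOrd 𝒪[F] w) (hdec : DecomposesEnd F w)
    (hρ : 1 ≤ ρ) (hΛ : IsStrictPureLift ι Γ ρ Λ) :
    Γ.normalizer = Λ.normalizer.comap (Units.map ((commutant ι).val : commutant ι →* A)) := by
  ext g
  rw [Subgroup.mem_comap]
  constructor
  · intro hg
    obtain ⟨n, hn⟩ := mem_normalizer_iff.1 hg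
    obtain ⟨e, he, hsh⟩ := Λ.exists_forall_apply_mem_iff hw
    have hconj : ∀ (k : ℤ) (b : commutant ι), b ∈ Γ.filtration k →
        (g : commutant ι) * b * (↑g⁻¹ : commutant ι) ∈ Γ.filtration k := by
      intro k b hb l v hv
      have h1 : (↑g⁻¹ : commutant ι) • v ∈ Γ.lat (l - n) := by
        rw [← hn, smul_smul, Units.mul_inv, one_smul, sub_add_cancel]
        exact hv
      have h2 := (hn _ _).2 (hb _ _ h1)
      rw [mul_smul, mul_smul]
      convert h2 using 2
      ring
    apply mem_normalizer_of_forall_le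
    intro x y hx hy
    change Λ.ord (((g : commutant ι) : A) • x) + _ ≤ Λ.ord (((g : commutant ι) : A) • y) + _
    have hg0 : ∀ v : V, v ≠ 0 → ((g : commutant ι) : A) • v ≠ 0 := by
      intro v hv h0
      apply hv
      have h1 : ((↑g⁻¹ : commutant ι) * (g : commutant ι)) • v = 0 := by
        rw [mul_smul]
        exact (congrArg (fun z : V => (↑g⁻¹ : commutant ι) • z) h0).trans (smul_zero _)
      rwa [Units.inv_mul, one_smul] at h1
    obtain ⟨T, d, b, h3, h4⟩ := Λ.exists_sum_commutant hdec hsh hΛ.2.1 hx (y := y)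
    -- As `D` commutes with `g`, applying `g` replaces `b t` by its conjugate and `x` by `g • x`.
    have h5 : ((g : commutant ι) : A) • y = ∑ t ∈ T, d t
        ((((g : commutant ι) * b t * (↑g⁻¹ : commutant ι) : commutant ι) : A) •
          ((g : commutant ι) : A) • x) := by
      rw [h3, Finset.smul_sum]
      refine Finset.sum_congr rfl fun t _ => ?_
      rw [← map_smul, smul_smul, smul_smul, ← MulMemClass.coe_mul, ← MulMemClass.coe_mul,
        mul_assoc ((g : commutant ι) * b t), Units.inv_mul, mul_one]
    obtain ⟨t, -, h6, h7⟩ := Λ.exists_ord_le_of_eq_sum (hg0 y hy) h5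
    obtain ⟨hd, hb⟩ := h4 t
    have h8 := (hΛ.2.2 _ _).2 (hconj _ _ ((hΛ.2.2 _ _).1 hb))
    have h9 : (((g : commutant ι) * b t * (↑g⁻¹ : commutant ι) : commutant ι) : A) •
          ((g : commutant ι) : A) • x ≠ 0 := fun h => h6 (by rw [h, map_zero])
    have h10 := (Λ.mem_filtration_iff.1 h8) _ (hg0 x hx) h9
    rw [Λ.ord_apply hsh hd h9] at h7
    omega
  · intro hg
    obtain ⟨n, hn⟩ := mem_normalizer_iff.1 hg
    obtain ⟨j, ψ, hψ⟩ := hdec.exists_commutant_linearMap ι VE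
    have hj : Function.Injective j := Function.LeftInverse.injective hψ
    have h1 : ∀ (k : ℤ) (b : commutant ι), b ∈ Γ.filtration k → (b : A) ∈ Λ.filtration (ρ * k) :=
      fun k b hb => (hΛ.2.2 _ _).2 (Γ.filtration_anti ((ceil_intCast_div_le_iff hρ).2 le_rfl) hb)
    have hg0 : ∀ v : VE, v ≠ 0 → (g : commutant ι) • v ≠ 0 := by
      intro v hv h0
      apply hv
      have := congrArg (fun z => (↑g⁻¹ : commutant ι) • z) h0
      simpa [smul_smul] using this
    have h2 : ∀ v : VE, v ≠ 0 → (n : ℤ) = ρ * (Γ.ord ((g : commutant ι) • v) - Γ.ord v) := by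
      intro v hv
      have h3 := ord_map_eq j hj h1 hv (hg0 v hv)
      have h4 : Λ.ord (j ((g : commutant ι) • v)) = Λ.ord (j v) + n :=
        Λ.ord_eq_of_forall_mem_iff (by rw [Ne, map_eq_zero_iff j hj]; exact hg0 v hv)
          (by rwa [Ne, map_eq_zero_iff j hj]) fun k => by rw [map_smul]; exact hn k (j v)
      omega
    apply mem_normalizer_of_forall_le
    intro x y hx hy
    have h3 := mul_left_cancel₀ (by positivity : (ρ : ℤ) ≠ 0) ((h2 x hx).symm.trans (h2 y hy))
    omega

end LatticeSeq

/-! ### Construction of the lift -/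

namespace LatticeSeq

variable {F : Type*} [Field F] [ValuativeRel F] [TopologicalSpace F] [IsNonarchimedeanLocalField F]
  {A : Type*} [Ring A] [Algebra F A]
  {V : Type*} [AddCommGroup V] [Module F V] [Module A V] [IsScalarTower F A V]
  [IsSimpleModule A V] {w : Module.End A V → ℤ}

/-- The lattice sequence with given lattices, on which `D` acts through its valuation `w`. -/
def ofShift (hw : IsNormalizedOrd 𝒪[F] w) (lat : ℤ → Submodule 𝒪[F] V) (hfg : ∀ k, (lat k).FG)
    (hspan : ∀ k, Submodule.span F (lat k : Set V) = ⊤) (hanti : Antitone lat) {e : ℤ} (he : 1 ≤ e)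
    (hsh : ∀ δ : Module.End A V, δ ≠ 0 → ∀ k v, δ v ∈ lat (k + e * w δ) ↔ v ∈ lat k) :
    LatticeSeq F A V where
  lat := lat
  isLattice k := ⟨hfg k, hspan k, fun δ hδ v hv => by
    by_cases h0 : δ = 0
    · simp [h0]
    have h1 : 0 ≤ w δ := (hw.isIntegral_iff δ h0).1 hδ
    exact hanti (le_add_of_nonneg_right (by positivity)) ((hsh δ h0 k v).2 hv)⟩
  antitone := hanti
  exists_period := ⟨e, he, fun k => by
    apply le_antisymm
    · intro v hv
      obtain ⟨ϖ, hϖ0, hϖ1⟩ := hw.exists_eq_one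
      obtain ⟨ε, hε, h1, h2, h3⟩ := Module.End.exists_mul_eq_one_of_isNormalizedOrd hw hϖ0
      have h4 : ϖ (ε v) = v := DFunLike.congr_fun h1 v
      refine Submodule.subset_span ⟨ϖ, (mem_maxIdealD_iff hw hϖ0).2 hϖ1.ge, ε v, ?_, h4⟩
      rw [← hsh ϖ hϖ0, hϖ1, mul_one, h4]
      exact hv
    · refine Submodule.span_le.2 ?_
      rintro _ ⟨δ, hδ, v, hv, rfl⟩
      by_cases h0 : δ = 0
      · simp [h0]
      have h1 : 1 ≤ w δ := (mem_maxIdealD_iff hw h0).1 hδ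
      exact hanti (by nlinarith) ((hsh δ h0 k v).2 hv)⟩

variable {B : Type*} [Ring B] [Algebra F B]
  {W : Type*} [AddCommGroup W] [Module F W] [Module B W] [IsScalarTower F B W]

/-- The vectors `v` such that `ψ (d v)` lies in `Γ_{(k + e w(d)) / ρ}` for all `d` in `D`. -/
def pullback (Γ : LatticeSeq F B W) (ψ : V →ₗ[F] W) (w : Module.End A V → ℤ) (e : ℤ) (ρ : ℕ)
    (k : ℤ) : Submodule 𝒪[F] V where
  carrier := {v | ∀ d : Module.End A V, d ≠ 0 → ψ (d v) ∈ Γ.lat ⌈((k + e * w d : ℤ) : ℝ) / (ρ : ℝ)⌉}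
  add_mem' := fun {a b} ha hb d hd => by
    rw [map_add, map_add]; exact add_mem (ha d hd) (hb d hd)
  zero_mem' := fun d hd => by rw [map_zero, map_zero]; exact Submodule.zero_mem _
  smul_mem' := fun c a ha d hd => by
    have h1 : ψ (d (c • a)) = c • ψ (d a) :=
      (ψ.comp (Module.End.toEndBase F d)).map_smul (c : F) a
    rw [h1]; exact Submodule.smul_mem _ _ (ha d hd)

variable {Γ : LatticeSeq F B W} {ψ : V →ₗ[F] W} {e : ℤ} {ρ : ℕ}

theorem apply_mem_pullback_iff (hw : IsNormalizedOrd 𝒪[F] w) {δ : Module.End A V} (hδ : δ ≠ 0)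
    (k : ℤ) (v : V) : δ v ∈ pullback Γ ψ w e ρ (k + e * w δ) ↔ v ∈ pullback Γ ψ w e ρ k := by
  obtain ⟨ε, hε, h1, h2, h3⟩ := Module.End.exists_mul_eq_one_of_isNormalizedOrd hw hδ
  have hmul0 : ∀ {δ ε : Module.End A V}, δ ≠ 0 → ε ≠ 0 → δ * ε ≠ 0 := by
    classical
    exact fun h1 h2 => mul_ne_zero h1 h2
  constructor
  · intro h d hd
    have h4 := h (d * ε) (hmul0 hd hε)
    rw [hw.map_mul _ _ hd hε, h3, ← Module.End.mul_apply, mul_assoc, h2, mul_one,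
      show k + e * w δ + e * (w d + -w δ) = k + e * w d by ring] at h4
    exact h4
  · intro h d hd
    have h4 := h (d * δ) (hmul0 hd hδ)
    rw [hw.map_mul _ _ hd hδ] at h4
    rw [show k + e * w δ + e * w d = k + e * (w d + w δ) by ring]
    exact h4

theorem pullback_antitone : Antitone (pullback Γ ψ w e ρ) := by
  intro k l hkl v hv d hd
  refine Γ.antitone (Int.ceil_mono (div_le_div_of_nonneg_right ?_ (by positivity))) (hv d hd)
  exact_mod_cast add_le_add_left hkl (e * w d)

variable [FiniteDimensional F V]

/-- Testing against a basis of `D` embeds the pullback into a finite product of lattices over the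
noetherian ring `𝒪[F]`. -/
theorem fg_pullback (hψ : ∀ v, (∀ d : Module.End A V, ψ (d v) = 0) → v = 0) (k : ℤ) :
    (pullback Γ ψ w e ρ k).FG := by
  haveI : FiniteDimensional F (Module.End A V) := Module.End.finiteDimensional_of_isScalarTower F A V
  let bas := Module.finBasis F (Module.End A V)
  let Φ : V →ₗ[F] (Fin (Module.finrank F (Module.End A V)) → W) :=
    LinearMap.pi fun i => ψ.comp (Module.End.toEndBase F (bas i))
  have hΦ : Function.Injective Φ := by
    rw [← LinearMap.ker_eq_bot, LinearMap.ker_eq_bot']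
    intro v hv
    refine hψ v fun d => ?_
    let f : Module.End A V →ₗ[F] W :=
      ψ.comp ((LinearMap.applyₗ v).comp (Module.End.toEndBase F).toLinearMap)
    have h1 : f = 0 := bas.ext fun i => congrFun hv i
    exact DFunLike.congr_fun h1 d
  let M : Submodule 𝒪[F] (Fin (Module.finrank F (Module.End A V)) → W) :=
    Submodule.pi Set.univ fun i => Γ.lat ⌈((k + e * w (bas i) : ℤ) : ℝ) / (ρ : ℝ)⌉
  have hM : M.FG := Submodule.fg_pi fun i => (Γ.isLattice _).fg
  haveI : Module.Finite 𝒪[F] M := Module.Finite.iff_fg.2 hM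
  let g : pullback Γ ψ w e ρ k →ₗ[𝒪[F]] M :=
    ((Φ.restrictScalars 𝒪[F]).comp (Submodule.subtype _)).codRestrict M fun v i _ =>
      v.2 (bas i) (bas.ne_zero i)
  have hg : Function.Injective g := fun u v h => Subtype.ext (hΦ (congrArg Subtype.val h))
  haveI : IsNoetherian 𝒪[F] (pullback Γ ψ w e ρ k) := isNoetherian_of_injective g hg
  exact Module.Finite.iff_fg.1 inferInstance

variable [IsSimpleModule B W] [FiniteDimensional F W]

theorem zpow_smul_mem_iff {π : F} (hπ : π ≠ 0) {m : ℤ}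
    (hm : ∀ k v, π • v ∈ Γ.lat (k + m) ↔ v ∈ Γ.lat k) (z k : ℤ) (v : W) :
    π ^ z • v ∈ Γ.lat (k + z * m) ↔ v ∈ Γ.lat k := by
  induction z using Int.induction_on generalizing k v with
  | zero => simp
  | succ n ih =>
    rw [zpow_add_one₀ hπ, mul_smul, add_mul, one_mul, add_comm (_ * m), ← add_assoc, ih, hm]
  | pred n ih =>
    rw [zpow_sub_one₀ hπ, mul_smul, sub_mul, one_mul, ← add_sub_assoc, add_sub_right_comm, ih,
      ← hm, smul_inv_smul₀ hπ, sub_add_cancel]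

/-- By `hem`, the condition at `d` is equivalent to a condition at `π ^ (-s) * d`, so only
valuations in `[0, p)` matter. Such elements are integral, hence lie in a finitely generated module,
and a power of `π` times `v` meets all conditions. -/
theorem span_pullback_eq_top (hw : IsNormalizedOrd 𝒪[F] w) (hρ : 1 ≤ ρ) {π : 𝒪[F]}
    (hπ : Irreducible π) (he : 1 ≤ e) {m : ℤ} (hm0 : 0 < m)
    (hm : ∀ k v, (π : F) • v ∈ Γ.lat (k + m) ↔ v ∈ Γ.lat k)
    (hem : e * w (algebraMap F _ (π : F)) = ρ * m) (k : ℤ) :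
    Submodule.span F (pullback Γ ψ w e ρ k : Set V) = ⊤ := by
  classical
  haveI : Nontrivial V := IsSimpleModule.nontrivial A V
  have hπ0 : (π : F) ≠ 0 := fun h => hπ.ne_zero (Subtype.ext h)
  have hp := map_uniformizer_pos hw hπ
  set p := w (algebraMap F (Module.End A V) (π : F)) with hpdef
  rw [eq_top_iff]
  rintro v -
  obtain ⟨S, hS⟩ := hw.exists_finset
  choose K hK using fun s : Module.End A V => Γ.exists_mem_lat (ψ (s v))
  obtain ⟨K₁, hK₁⟩ := (S.image fun s => -K s).exists_le
  set K₀ := -K₁ with hK₀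
  have hint : ∀ d : Module.End A V, IsIntegral 𝒪[F] d → ψ (d v) ∈ Γ.lat K₀ := by
    intro d hd
    have h1 := hS d hd
    clear hd
    induction h1 using Submodule.span_induction with
    | mem d h =>
      have h2 := hK₁ _ (Finset.mem_image_of_mem _ h)
      exact Γ.antitone (by omega : K₀ ≤ K d) (hK d)
    | zero => rw [LinearMap.zero_apply, map_zero]; exact Submodule.zero_mem _
    | add a b _ _ ha hb => rw [LinearMap.add_apply, map_add]; exact add_mem ha hb
    | smul c a _ ha =>
      have h2 : ψ ((c • a) v) = c • ψ (a v) := ψ.map_smul (c : F) (a v)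
      rw [h2]; exact Submodule.smul_mem _ _ ha
  -- `C` is the level that suffices for all remainders below `p`; `K₀` is a level containing `ψ (d
  -- v)` for all integral `d`, and `q` powers of `π` lift `K₀` past `C`.
  set C := ⌈((k + e * p : ℤ) : ℝ) / (ρ : ℝ)⌉ with hC
  have hC' := (ceil_intCast_div_le_iff hρ).1 hC.ge
  set q : ℤ := ((C - K₀).toNat : ℤ) with hq
  have hqm : C ≤ K₀ + q * m := by
    have h1 : C - K₀ ≤ q := Int.self_le_toNat _
    have h2 : q ≤ q * m := le_mul_of_one_le_right (by positivity) hm0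
    omega
  have hmem : (π : F) ^ q • v ∈ pullback Γ ψ w e ρ k := by
    intro d hd
    set s := w d / p with hs
    have hs0 : (π : F) ^ (-s) ≠ 0 := zpow_ne_zero _ hπ0
    have hd0 : algebraMap F (Module.End A V) ((π : F) ^ (-s)) ≠ 0 := by
      rwa [Ne, map_eq_zero_iff _ (algebraMap F (Module.End A V)).injective]
    have hwd : w (algebraMap F (Module.End A V) ((π : F) ^ (-s)) * d) = w d - s * p := by
      have hπ1 : algebraMap F (Module.End A V) (π : F) ≠ 0 := by simpa using hπ0
      rw [hw.map_mul _ _ hd0 hd, map_zpow₀, hw.map_zpow hπ1]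
      ring
    have hmod := Int.emod_add_ediv_mul (w d) p
    have hmod0 := Int.emod_nonneg (w d) hp.ne'
    have hmod1 := Int.emod_lt_of_pos (w d) hp
    rw [← hs] at hmod
    have h1 := hint _ ((hw.isIntegral_iff _ (mul_ne_zero hd0 hd)).2 (by omega))
    have h2 : ψ (d ((π : F) ^ q • v)) = (π : F) ^ s • (π : F) ^ q •
        ψ ((algebraMap F (Module.End A V) ((π : F) ^ (-s)) * d) v) := by
      have h3 : (algebraMap F (Module.End A V) ((π : F) ^ (-s)) * d) v =
        (π : F) ^ (-s) • d v := rfl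
      have h4 : d ((π : F) ^ q • v) = (π : F) ^ q • d v := (Module.End.toEndBase F d).map_smul _ _
      rw [h3, h4, map_smul, map_smul, smul_comm, smul_smul ((π : F) ^ s), ← zpow_add₀ hπ0,
        add_neg_cancel, zpow_zero, one_smul]
    rw [h2]
    refine Γ.antitone ?_ ((zpow_smul_mem_iff hπ0 hm s _ _).2 ((zpow_smul_mem_iff hπ0 hm q _ _).2 h1))
    rw [ceil_intCast_div_le_iff hρ]
    have h5 : e * w d ≤ e * (p + s * p) := mul_le_mul_of_nonneg_left (by omega) (by omega)
    have h6 : e * (p + s * p) = e * p + s * (ρ * m) := by rw [← hem]; ring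
    have h7 : (ρ : ℤ) * C ≤ ρ * (K₀ + q * m) := mul_le_mul_of_nonneg_left hqm (by positivity)
    rw [mul_add (ρ : ℤ) (K₀ + q * m)]
    have h8 : (ρ : ℤ) * (s * m) = s * (ρ * m) := by ring
    omega
  have h9 := Submodule.smul_mem _ ((π : F) ^ q)⁻¹ (Submodule.subset_span (R := F) hmem)
  rwa [inv_smul_smul₀ (zpow_ne_zero _ hπ0)] at h9

end LatticeSeq

theorem LatticeSeq.exists_isStrictPureLift
    {F : Type*} [Field F] [ValuativeRel F] [TopologicalSpace F] [IsNonarchimedeanLocalField F]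
    {A : Type*} [Ring A] [Algebra F A] [IsSimpleRing A]
    {V : Type*} [AddCommGroup V] [Module F V] [Module A V] [IsScalarTower F A V]
    [IsSimpleModule A V] [FiniteDimensional F V] {w : Module.End A V → ℤ}
    {E : Type*} [Field E] [Algebra F E] (ι : E →ₐ[F] A)
    {VE : Type*} [AddCommGroup VE] [Module F VE] [Module (commutant ι) VE]
    [IsScalarTower F (commutant ι) VE] [IsSimpleModule (commutant ι) VE] [FiniteDimensional F VE]
    (Γ : LatticeSeq F (commutant ι) VE) (hΓ : Γ.IsStrict)
    (hw : IsNormalizedOrd 𝒪[F] w) (hdec : DecomposesEnd F w) :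
    ∃ (ρ : ℕ) (Λ : LatticeSeq F A V), 1 ≤ ρ ∧ IsStrictPureLift ι Γ ρ Λ := by
  haveI : Nontrivial VE := IsSimpleModule.nontrivial (commutant ι) VE
  haveI : Nontrivial V := IsSimpleModule.nontrivial A V
  obtain ⟨j, ψ, hjψ⟩ := hdec.exists_commutant_linearMap ι VE
  have hj : Function.Injective j := Function.LeftInverse.injective hjψ
  -- The common kernel of the maps `ψ ∘ d` is stable under `D` and `B`; were it nonzero it would be
  -- all of `V`, contradicting `ψ ∘ j = id`.
  have hψ : ∀ v, (∀ d : Module.End A V, ψ.restrictScalars F (d v) = 0) → v = 0 := by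
    intro v hv
    by_contra hv0
    let S : AddSubgroup V :=
      { carrier := {u | ∀ d : Module.End A V, ψ (d u) = 0}
        add_mem' := fun {a b} ha hb d => by rw [map_add, map_add, ha, hb, add_zero]
        zero_mem' := fun d => by rw [map_zero, map_zero]
        neg_mem' := fun {a} ha d => by rw [map_neg, map_neg, ha, neg_zero] }
    have hS : ∀ y, y ∈ S := hdec.mem_of_forall_mem ι S (fun δ u hu d => hu (d * δ))
      (fun b u hu d => by
        have h1 : ψ (d ((b : A) • u)) = b • ψ (d u) := by
          rw [map_smul]; exact ψ.map_smul b (d u)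
        rw [h1, hu, smul_zero]) hv0 hv
    obtain ⟨x, hx⟩ := exists_ne (0 : VE)
    exact hx ((hjψ x).symm.trans (hS (j x) 1))
  obtain ⟨π, hπ⟩ := IsDiscreteValuationRing.exists_irreducible 𝒪[F]
  obtain ⟨m, hm0, hm⟩ := Γ.exists_smul_mem_iff hπ
  have hn0 := map_uniformizer_pos hw hπ
  set n := w (algebraMap F (Module.End A V) (π : F)) with hn
  -- `π` must shift the lift by `e * n` and by `ρ * m`; the fraction is taken in lowest terms to
  -- obtain strictness.
  obtain ⟨e, ρ, he, hρ, hem, hcop⟩ : ∃ (e : ℤ) (ρ : ℕ), 1 ≤ e ∧ 1 ≤ ρ ∧ e * n = ρ * m ∧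
      IsCoprime (ρ : ℤ) e := by
    have hg : 0 < Int.gcd m n := Int.gcd_pos_of_ne_zero_left _ hm0.ne'
    obtain ⟨m', n', hcop, hm', hn'⟩ := Int.exists_gcd_one hg
    have hg' : (0 : ℤ) < Int.gcd m n := by exact_mod_cast hg
    have hm'0 : 0 < m' := (mul_pos_iff_of_pos_right hg').1 (by rw [← hm']; exact hm0)
    have hn'0 : 0 < n' := (mul_pos_iff_of_pos_right hg').1 (by rw [← hn']; exact hn0)
    have hna : (n'.toNat : ℤ) = n' := Int.toNat_of_nonneg hn'0.le
    refine ⟨m', n'.toNat, hm'0, by omega, ?_, ?_⟩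
    · rw [hna]
      linear_combination m' * hn' - n' * hm'
    · rw [hna]
      exact (Int.isCoprime_iff_gcd_eq_one.2 hcop).symm
  let Λ : LatticeSeq F A V := ofShift hw (pullback Γ (ψ.restrictScalars F) w e ρ)
    (fg_pullback hψ) (span_pullback_eq_top hw hρ hπ he hm0 hm hem) pullback_antitone he
    fun δ hδ k v => apply_mem_pullback_iff hw hδ k v
  have hsh : ∀ δ : Module.End A V, δ ≠ 0 → ∀ k v, δ v ∈ Λ.lat (k + e * w δ) ↔ v ∈ Λ.lat k :=
    fun δ hδ k v => apply_mem_pullback_iff hw hδ k v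
  have hsmul : ∀ (b : commutant ι) (d : Module.End A V) (v : V),
      ψ (d ((b : A) • v)) = b • ψ (d v) := fun b d v => by
    rw [map_smul]; exact ψ.map_smul b (d v)
  have hfil : ∀ (k : ℤ) (b : commutant ι), b ∈ Γ.filtration ⌈(k : ℝ) / (ρ : ℝ)⌉ →
      (b : A) ∈ Λ.filtration k := by
    intro k b hb l v hv d hd
    have h1 := hb _ _ (hv d hd)
    change ψ (d ((b : A) • v)) ∈ _
    rw [hsmul]
    refine Γ.antitone ?_ h1
    rw [ceil_intCast_div_le_iff hρ, mul_add]
    have h2 := (ceil_intCast_div_le_iff (k := k) hρ).1 le_rfl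
    have h3 := (ceil_intCast_div_le_iff (k := l + e * w d) hρ).1 le_rfl
    omega
  have hord : ∀ x y : VE, x ≠ 0 → y ≠ 0 →
      Λ.ord (j y) = Λ.ord (j x) + ρ * (Γ.ord y - Γ.ord x) := fun x y hx hy =>
    ord_map_eq j hj (fun k b hb => hfil _ b (Γ.filtration_anti
      ((ceil_intCast_div_le_iff hρ).2 le_rfl) hb)) hx hy
  have hj0 : ∀ {x}, x ≠ 0 → j x ≠ 0 := fun hx => by rwa [Ne, map_eq_zero_iff j hj]
  refine ⟨ρ, Λ, hρ, ?_, ?_, fun k b => ⟨fun hb => ?_, hfil k b⟩⟩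
  · refine strictAnti_int_of_succ_lt fun k => ?_
    obtain ⟨x, hx, hx0⟩ := hΓ.exists_ord_eq 0
    -- From `s * ρ + t * e = 1`, a vector of `Γ`-order `c * s` moved by an element of `D` of
    -- valuation `c * t` attains the order `k`.
    obtain ⟨s, t, hst⟩ := hcop
    set c := k - Λ.ord (j x) with hc
    obtain ⟨y, hy, hy0⟩ := hΓ.exists_ord_eq (c * s)
    obtain ⟨ϖ, hϖ0, hϖ1⟩ := hw.exists_eq_one
    obtain ⟨δ, hδ, hδw⟩ : ∃ δ : Module.End A V, δ ≠ 0 ∧ w δ = c * t := by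
      classical
      exact ⟨ϖ ^ (c * t), zpow_ne_zero _ hϖ0, by rw [hw.map_zpow hϖ0, hϖ1, mul_one]⟩
    have h1 := Λ.ord_apply hsh hδ (hj0 hy)
    rw [hord x y hx hy, hx0, hy0, hδw] at h1
    have h2 : Λ.ord (δ (j y)) = k := by
      rw [h1]
      linear_combination c * hst
    have h3 : δ (j y) ≠ 0 := by
      obtain ⟨ε, -, h4⟩ := Module.End.exists_mul_eq_one hδ
      intro h0
      apply hj0 hy
      rw [← Module.End.one_apply (R := A) (j y), ← h4, Module.End.mul_apply, h0, map_zero]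
    refine lt_of_le_of_ne (Λ.antitone (by omega)) fun heq => ?_
    have h4 := (Λ.mem_lat_iff h3).2 h2.ge
    rw [← heq, Λ.mem_lat_iff h3] at h4
    omega
  · intro x
    obtain ⟨wB, hwB⟩ := exists_isNormalizedOrd_end F (commutant ι) VE
    obtain ⟨eB, -, hB⟩ := Γ.exists_forall_apply_mem_iff hwB
    let z : commutant ι := ⟨ι x, by
      rw [Subalgebra.mem_centralizer_iff]
      rintro _ ⟨y, rfl⟩
      rw [← map_mul, ← map_mul, mul_comm]⟩
    have hz : ∀ b, z * b = b * z := fun b =>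
      Subtype.ext ((Subalgebra.mem_centralizer_iff F).1 b.2 _ ⟨x, rfl⟩)
    -- The image of `x` is central in `B`, so it acts on `V_E` through `D_E` and shifts `Γ` by a
    -- constant; `ρ` times this constant is the shift on `Λ`.
    let δ : Module.End (commutant ι) VE :=
      { toFun := fun v => z • v
        map_add' := smul_add z
        map_smul' := fun b v => by rw [smul_smul, hz, mul_smul]; rfl }
    have hδ : δ ≠ 0 := by
      intro h0
      obtain ⟨y, hy⟩ := exists_ne (0 : VE)
      have h1 : z • y = 0 := DFunLike.congr_fun h0 y
      have h2 : ι x • j y = 0 := by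
        have h2 := j.map_smul z y
        rw [h1, map_zero] at h2
        exact h2.symm
      have h3 := congrArg (fun v => ι ((x⁻¹ : Eˣ) : E) • v) h2
      simp only [smul_smul, ← map_mul, Units.inv_mul, map_one, one_smul, smul_zero] at h3
      exact hj0 hy h3
    rw [mem_normalizer_iff]
    refine ⟨ρ * (eB * wB δ), fun k v => forall_congr' fun d => forall_congr' fun hd => ?_⟩
    change ψ (d ((z : A) • v)) ∈ _ ↔ ψ (d v) ∈ _
    rw [hsmul]
    have h1 : ⌈((k + ρ * (eB * wB δ) + e * w d : ℤ) : ℝ) / (ρ : ℝ)⌉ =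
        ⌈((k + e * w d : ℤ) : ℝ) / (ρ : ℝ)⌉ + eB * wB δ := by
      refine eq_of_forall_ge_iff fun l => ?_
      rw [← le_sub_iff_add_le, ceil_intCast_div_le_iff hρ, ceil_intCast_div_le_iff hρ, mul_sub]
      constructor <;> intro h <;> linarith
    rw [h1]
    exact hB δ hδ _ _
  · rw [filtrationReal, mem_filtration_iff]
    intro v hv hbv
    have h1 : j (b • v) = (b : A) • j v := j.map_smul b v
    have h2 := Λ.mem_filtration_iff.1 hb (j v) (hj0 hv) (by rw [← h1]; exact hj0 hbv)
    rw [← h1, hord v _ hv hbv] at h2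
    have h3 : ⌈(k : ℝ) / (ρ : ℝ)⌉ ≤ Γ.ord (b • v) - Γ.ord v := by
      rw [ceil_intCast_div_le_iff hρ]; omega
    omega

theorem mainTheorem8
    {F : Type*} [Field F] [ValuativeRel F] [TopologicalSpace F] [IsNonarchimedeanLocalField F]
    {A : Type*} [Ring A] [Algebra F A] [FiniteDimensional F A] [Algebra.IsCentral F A]
    [IsSimpleRing A]
    {V : Type*} [AddCommGroup V] [Module F V] [Module A V] [IsScalarTower F A V]
    [IsSimpleModule A V]
    {E : Type*} [Field E] [Algebra F E] [FiniteDimensional F E] (ι : E →ₐ[F] A)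
    {VE : Type*} [AddCommGroup VE] [Module F VE] [Module (commutant ι) VE]
    [IsScalarTower F (commutant ι) VE] [IsSimpleModule (commutant ι) VE]
    (Γ : LatticeSeq F (commutant ι) VE) (hΓ : Γ.IsStrict) :
    ∃ (ρ : ℕ) (Λ : LatticeSeq F A V),
      1 ≤ ρ ∧ IsStrictPureLift ι Γ ρ Λ ∧
      (∀ (ρ' : ℕ) (Λ' : LatticeSeq F A V), 1 ≤ ρ' → IsStrictPureLift ι Γ ρ' Λ' →
        ρ' = ρ ∧ Λ.IsTranslate Λ') ∧
      Γ.normalizer = Λ.normalizer.comap (Units.map ((commutant ι).val : commutant ι →* A)) := by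
  haveI : FiniteDimensional F V := finiteDimensional_of_isSimpleModule F A V
  haveI : FiniteDimensional F VE := finiteDimensional_of_isSimpleModule F (commutant ι) VE
  obtain ⟨w, hw, hdec⟩ := exists_isNormalizedOrd_decomposesEnd F A V
  obtain ⟨ρ, Λ, hρ, hΛ⟩ := LatticeSeq.exists_isStrictPureLift ι Γ hΓ hw hdec
  exact ⟨ρ, Λ, hρ, hΛ,
    fun ρ' Λ' hρ' hΛ' => LatticeSeq.eq_and_isTranslate hw hdec hρ hρ' hΛ hΛ',
    LatticeSeq.normalizer_eq_comap hw hdec hρ hΛ⟩
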